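/- **Setting.** Fix $p\ge 0$. For $\lambda=(\lambda_1,\dots,\lambda_p)$ with $\lambda_1\ge\dots\ge\lambda_p\ge 0$ let $J_\lambda(\beta)=\sum_{i=1}^p\lambda_i|\beta|_{(i)}$ be the SLOPE norm on $\mathbb R^p$, where $|\beta|_{(1)}\ge\dots\ge|\beta|_{(p)}$ are the ordered absolute values of the coordinates of $\beta$, and let $J'_\lambda(\beta^0;u)=\lim_{t\searrow 0}\big(J_\lambda(\beta^0+tu)-J_\lambda(\beta^0)\big)/t$. The SLOPE pattern $\mathbf{patt}:\mathbb R^p\to\mathbb Z^p$ is $\mathbf{patt}(u)_i=\operatorname{rank}(|u_i|)\operatorname{sgn}(u_i)$, where $\operatorname{rank}(|u_i|)$ is the rank of $|u_i|$ among the distinct nonzero values of $|u_1|,\dots,|u_p|$ (the smallest nonzero value has rank $1$). The limiting pattern is $\mathbf{patt}_{\beta^0}(u)=\lim_{t\searrow0}\mathbf{patt}(\beta^0+tu)$. For a random vector $b$ with real or integer coordinates, $\mathrm{FDR}(b)=\mathbb E\big[V/(1\vee R)\big]$, where $R=|\{i:b_i\ne0\}|$ and $V=|\{i:b_i\neq0,\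 \beta^0_i=0\}|$. Let $z_i=(y_i,X_i)$, $i\ge1$, be i.i.d. random elements of $\mathbb R\times\mathbb R^p$. Let $g(z,\beta)$ be a real loss function that is convex in $\beta\in\mathbb R^p$ for every $z$ and, for every $\beta$, measurable in $z$ with $g(z_1,\beta)$ integrable. Put $G(\beta)=\mathbb E[g(z_1,\beta)]$ and $\nu_nf=n^{-1/2}\sum_{i=1}^n\big(f(z_i)-\mathbb E f(z_1)\big)$. Fix $\beta^0\in\mathbb R^p$ and a measurable $\triangle:\mathbb R\times\mathbb R^p\to\mathbb R^p$, and define the rest term $r$ by $$g(z,\beta)=g(z,\beta^0)+(\beta-\beta^0)^T\triangle(z)+\|\beta-\beta^0\|\,r(z,\beta),\qquad r(z,\beta^0)=0 .$$ **Theorem.** Let $\lambda^n\in\mathbb R^p$ with $\lambda^n_1\ge\dots\ge\lambda^n_p\ge0$ and $\lambda^n/\sqrt n\to\lambda$. Suppose that 1. $\beta^0$ minimises $G$, and $G$ is twice differentiable at $\beta^0$ with non-singular Hessian $\tilde C$; 2. $\mathbb E[\triangle(z_1)]=0$ and $\mathbb E\|\triangle(z_1)\|^2<\infty$; put $C_\triangle=\mathbb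 E[\triangle(z_1)\triangle(z_1)^T]$; 3. $g$ is stochastically differentiable at $\beta^0$: for every sequence of neighbourhoods $U_n$ shrinking to $\beta^0$, $\displaystyle\sup_{\beta\in U_n}\frac{|\nu_n r(\cdot,\beta)|}{1+\sqrt n\,\|\beta-\beta^0\|}\to0$ in (outer) probability. Let $\hat\beta_n$ be random vectors which, with (inner) probability tending to $1$, minimise $\beta\mapsto\frac1n\sum_{i=1}^n g(z_i,\beta)+J_{\lambda^n/n}(\beta)$, and let $\hat u_n=\sqrt n(\hat\beta_n-\beta^0)$. Let $\tilde W\sim\mathcal N(0,C_\triangle)$. Then $$V(u)=\tfrac12u^T\tilde Cu-u^T\tilde W+J'_\lambda(\beta^0;u)$$ always has a unique minimiser $\hat u$, the map $\hat u$ is a random vector (measurable up to null sets), and $\hat u_n$ converges in distribution to $\hat u$. If moreover $C_\triangle$ is non-singular, then $\mathbf{patt}(\hat u_n)$ converges in distribution to $\mathbf{patt}(\hat u)$, $\mathbf{patt}(\hat\beta_n)$ converges in distribution to $\mathbf{patt}_{\beta^0}(\hat u)$, and $\mathrm{FDR}(\hat\beta_n)\to\mathrm{FDR}(\mathbf{patt}_{\beta^0}(\hat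 u))$. -/

import Mathlib

open MeasureTheory ProbabilityTheory Filter Topology

/-- The SLOPE norm `J_lam(β) = ∑ i, lam_i |β|_(i)`, where `|β|_(1) ≥ … ≥ |β|_(p)` are the absolute
values of the coordinates of `β` in decreasing order. -/
noncomputable def slopeNorm {p : ℕ} (lam : Fin p → ℝ) (β : EuclideanSpace ℝ (Fin p)) : ℝ :=
  ∑ i, lam i * |β (Tuple.sort (fun j => -|β j|) i)|

/-- The directional derivative `J'_lam(β₀; u) = lim_{t ↘ 0} (J_lam(β₀ + t u) - J_lam(β₀)) / t`. -/
noncomputable def slopeDirDeriv {p : ℕ} (lam : Fin p → ℝ) (β₀ u : EuclideanSpace ℝ (Fin p)) : ℝ :=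
  limUnder (𝓝[>] (0 : ℝ)) fun t => (slopeNorm lam (β₀ + t • u) - slopeNorm lam β₀) / t

/-- The rank of `|u_i|` among the distinct nonzero values of `|u_1|, …, |u_p|`: the smallest nonzero
value has rank one, and the value zero has rank zero. -/
noncomputable def slopeRank {p : ℕ} (u : EuclideanSpace ℝ (Fin p)) (i : Fin p) : ℕ :=
  ((Finset.univ.image fun j => |u j|).filter fun a => 0 < a ∧ a ≤ |u i|).card

/-- The SLOPE pattern `patt(u)_i = rank(|u_i|) sgn(u_i)`. -/
noncomputable def slopePattern {p : ℕ} (u : EuclideanSpace ℝ (Fin p)) : Fin p → ℤ :=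
  fun i => (slopeRank u i : ℤ) * (SignType.sign (u i) : ℤ)

/-- The limiting pattern `patt_{β₀}(u) = lim_{t ↘ 0} patt(β₀ + t u)`. -/
noncomputable def limitingPattern {p : ℕ} (β₀ u : EuclideanSpace ℝ (Fin p)) : Fin p → ℤ :=
  limUnder (𝓝[>] (0 : ℝ)) fun t => slopePattern (β₀ + t • u)

/-- The false discovery proportion `V / (1 ∨ R)`, where the hypothesis `β₀ i = 0` is rejected when
`b i ≠ 0`; `R` counts the rejections and `V` the false ones. -/
noncomputable def falseDiscoveryProportion {p : ℕ} {α : Type*} [Zero α]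
    (β₀ : EuclideanSpace ℝ (Fin p)) (b : Fin p → α) : ℝ :=
  ({i | b i ≠ 0 ∧ β₀ i = 0} : Set (Fin p)).ncard /
    max (1 : ℝ) (({i | b i ≠ 0} : Set (Fin p)).ncard)

/-- The false discovery rate: the expected false discovery proportion of the random vector `b`. -/
noncomputable def falseDiscoveryRate {p : ℕ} {α Ω : Type*} [Zero α] [MeasurableSpace Ω]
    (β₀ : EuclideanSpace ℝ (Fin p)) (μ : Measure Ω) (b : Ω → Fin p → α) : ℝ :=
  ∫ ω, falseDiscoveryProportion β₀ (b ω) ∂μ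

/-- `G` is twice differentiable at `β₀` with Hessian matrix `C`. -/
def HasHessianAt {p : ℕ} (G : EuclideanSpace ℝ (Fin p) → ℝ) (C : Matrix (Fin p) (Fin p) ℝ)
    (β₀ : EuclideanSpace ℝ (Fin p)) : Prop :=
  ∃ G' : EuclideanSpace ℝ (Fin p) → EuclideanSpace ℝ (Fin p),
    (∀ᶠ β in 𝓝 β₀, HasGradientAt G (G' β) β) ∧
      HasFDerivAt G' (Matrix.toEuclideanCLM (n := Fin p) (𝕜 := ℝ) C) β₀

/-- The empirical process `ν_n f = n^{-1/2} ∑_{i < n} (f(Z_i) - E f)`, with `E` taken under `P`. -/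
noncomputable def centredEmpiricalSum {Ω 𝒵 : Type*} [MeasurableSpace 𝒵] (P : Measure 𝒵)
    (Z : ℕ → Ω → 𝒵) (n : ℕ) (f : 𝒵 → ℝ) (ω : Ω) : ℝ :=
  (√(n : ℝ))⁻¹ * ∑ i ∈ Finset.range n, (f (Z i ω) - ∫ z, f z ∂P)

/-- The rest term `r` in
`g(z, β) = g(z, β₀) + (β - β₀)ᵀ Δ(z) + ‖β - β₀‖ r(z, β)`, with `r(z, β₀) = 0`. -/
noncomputable def expansionRest {p : ℕ} {𝒵 : Type*} (g : 𝒵 → EuclideanSpace ℝ (Fin p) → ℝ)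
    (Δ : 𝒵 → EuclideanSpace ℝ (Fin p)) (β₀ β : EuclideanSpace ℝ (Fin p)) (z : 𝒵) : ℝ :=
  (g z β - g z β₀ - inner ℝ (β - β₀) (Δ z)) / ‖β - β₀‖

/-- Stochastic differentiability of `g` at `β₀` with first-order term `Δ`: for all neighbourhoods
`U n` shrinking to `β₀`, the supremum over `β ∈ U n` of `|ν_n r(·, β)| / (1 + √n ‖β - β₀‖)`
converges to zero in (outer) probability. -/
def StochasticallyDifferentiableAt {p : ℕ} {Ω 𝒵 : Type*} [MeasurableSpace Ω] [MeasurableSpace 𝒵]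
    (μ : Measure Ω) (P : Measure 𝒵) (Z : ℕ → Ω → 𝒵) (g : 𝒵 → EuclideanSpace ℝ (Fin p) → ℝ)
    (Δ : 𝒵 → EuclideanSpace ℝ (Fin p)) (β₀ : EuclideanSpace ℝ (Fin p)) : Prop :=
  ∀ U : ℕ → Set (EuclideanSpace ℝ (Fin p)), (∀ n, U n ∈ 𝓝 β₀) →
    (∀ O ∈ 𝓝 β₀, ∀ᶠ n in atTop, U n ⊆ O) →
    ∀ ε : ℝ, 0 < ε →
      Tendsto (fun n : ℕ => μ {ω | ENNReal.ofReal ε ≤ ⨆ β ∈ U n,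
        ‖centredEmpiricalSum P Z n (expansionRest g Δ β₀ β) ω / (1 + √(n : ℝ) * ‖β - β₀‖)‖ₑ})
        atTop (𝓝 0)

/-- The second moment matrix `C_Δ = E[Δ Δᵀ]`. -/
noncomputable def secondMomentMatrix {p : ℕ} {𝒵 : Type*} [MeasurableSpace 𝒵] (P : Measure 𝒵)
    (Δ : 𝒵 → EuclideanSpace ℝ (Fin p)) : Matrix (Fin p) (Fin p) ℝ :=
  Matrix.of fun i j => ∫ z, Δ z i * Δ z j ∂P

/-- The penalised empirical risk `β ↦ (1/n) ∑_{i < n} g(Z_i, β) + J_{lam/n}(β)` at the data `Z`. -/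
noncomputable def penalizedRisk {p : ℕ} {𝒵 : Type*} (g : 𝒵 → EuclideanSpace ℝ (Fin p) → ℝ)
    (lam : Fin p → ℝ) (n : ℕ) (Z : ℕ → 𝒵) (β : EuclideanSpace ℝ (Fin p)) : ℝ :=
  (1 / (n : ℝ)) * ∑ i ∈ Finset.range n, g (Z i) β + slopeNorm ((n : ℝ)⁻¹ • lam) β

/-- The limiting objective `V(u) = ½ uᵀ C u - uᵀ w + J'_lam(β₀; u)`. -/
noncomputable def limitObjective {p : ℕ} (C : Matrix (Fin p) (Fin p) ℝ) (lam : Fin p → ℝ)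
    (β₀ w u : EuclideanSpace ℝ (Fin p)) : ℝ :=
  (1 / 2) * (u.ofLp ⬝ᵥ C.mulVec u.ofLp) - u.ofLp ⬝ᵥ w.ofLp + slopeDirDeriv lam β₀ u

/-! In the local coordinate u = √n(β − β₀), the penalised risk, multiplied by n and recentred, is
the convex function `localLoss` plus the SLOPE norm with weights λⁿ/√n taken at √n β₀ + u.
Stochastic differentiability and the Taylor expansion of G make `localLoss` uniformly close, on
bounded sets, to ½uᵀC̃u − uᵀS_n, where S_n is the normalised negative score; S_n tends to W̃ in
distribution by the central limit theorem.

The penalty needs no approximation. The signs of all u_i ± u_j (`rootSigns`, the faces of the type B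
hyperplane arrangement) determine the sorting permutation and the pattern, and the SLOPE norm is
linear on each face. For large T the signs at Tβ₀ + u are those of β₀ with ties broken by u,
uniformly for bounded u. So on each ball the penalty eventually equals a constant plus its
directional derivative, and the pattern of Tβ₀ + u is the limiting pattern. Convexity and uniqueness
of the limiting minimiser then give convergence of minimisers (`tendsto_localMinimizers`).

Patterns are discontinuous, so their convergence needs more: `ae_eventually_rootSigns_eq`. Suppose
minimisers u_k → u keep a sign vector σ other than that of u. Signs can only degenerate to zero in
the limit, so the sign subspace of u is strictly smaller than that of σ. Stationarity of u_k along
the σ-subspace passes to the limit as ⟨v, w⟩ = ⟨v, C̃u⟩ + ℓ_σ(v), with ℓ_σ linear. By a dimension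
count some nonzero v, depending only on the two sign vectors, is C̃-orthogonal to the smaller
subspace, which contains u. Hence w lies on one of finitely many fixed hyperplanes, and a
nondegenerate Gaussian law charges none of them.

These arguments are deterministic statements about sequences of realisations.
`measure_le_liminf_of_tendstoInDistribution` and `tendstoInDistribution_of_forall_seq` turn them
into convergence in distribution through the open-set portmanteau criterion, without any coupling.
The false discovery proportion is a bounded function of the pattern, so its mean converges too. -/

/-! ### Signs of the roots `u_i ± u_j` -/

/-- The linear functional `u ↦ u_i ± u_j`. -/
noncomputable def signedRoot {p : ℕ} (a : Fin p × Fin p × Bool) :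
    EuclideanSpace ℝ (Fin p) →L[ℝ] ℝ :=
  EuclideanSpace.proj a.1 + (if a.2.2 then (1 : ℝ) else -1) • EuclideanSpace.proj a.2.1

/-- The signs of all the functionals `u ↦ u_i ± u_j`. -/
noncomputable def rootSigns {p : ℕ} (u : EuclideanSpace ℝ (Fin p)) :
    Fin p × Fin p × Bool → SignType :=
  fun a => SignType.sign (signedRoot a u)

section RootSigns

variable {p : ℕ} {u v : EuclideanSpace ℝ (Fin p)}

lemma signedRoot_true (i j : Fin p) (u : EuclideanSpace ℝ (Fin p)) :
    signedRoot (i, j, true) u = u i + u j := by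
  simp [signedRoot]

lemma signedRoot_false (i j : Fin p) (u : EuclideanSpace ℝ (Fin p)) :
    signedRoot (i, j, false) u = u i - u j := by
  simp [signedRoot, sub_eq_add_neg]

lemma abs_signedRoot_le (a : Fin p × Fin p × Bool) (u : EuclideanSpace ℝ (Fin p)) :
    |signedRoot a u| ≤ 2 * ‖u‖ := by
  obtain ⟨i, j, b⟩ := a
  have hi : |u i| ≤ ‖u‖ := PiLp.norm_apply_le u i
  have hj : |u j| ≤ ‖u‖ := PiLp.norm_apply_le u j
  cases b
  · rw [signedRoot_false]
    linarith [abs_sub (u i) (u j)]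
  · rw [signedRoot_true]
    linarith [abs_add_le (u i) (u j)]

/-- Comparing absolute values is comparing squares, and u_i² − u_j² = (u_i − u_j)(u_i + u_j). -/
lemma abs_le_abs_iff_rootSigns (i j : Fin p) (u : EuclideanSpace ℝ (Fin p)) :
    |u i| ≤ |u j| ↔ rootSigns u (i, j, false) * rootSigns u (i, j, true) ≤ 0 := by
  rw [← sq_le_sq, rootSigns, rootSigns, signedRoot_true, signedRoot_false, ← sign_mul,
    ← sub_nonpos, sign_nonpos_iff]
  ring_nf

lemma abs_le_abs_iff_of_rootSigns_eq (h : rootSigns u = rootSigns v) (i j : Fin p) :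
    |u i| ≤ |u j| ↔ |v i| ≤ |v j| := by
  rw [abs_le_abs_iff_rootSigns, abs_le_abs_iff_rootSigns, h]

lemma abs_eq_abs_iff_of_rootSigns_eq (h : rootSigns u = rootSigns v) (i j : Fin p) :
    |u i| = |u j| ↔ |v i| = |v j| := by
  simp only [le_antisymm_iff, abs_le_abs_iff_of_rootSigns_eq h]

lemma rootSigns_diag (i : Fin p) (u : EuclideanSpace ℝ (Fin p)) :
    rootSigns u (i, i, true) = SignType.sign (u i) := by
  rw [rootSigns, signedRoot_true, ← two_mul, sign_mul]
  simp

lemma sign_apply_eq_of_rootSigns_eq (h : rootSigns u = rootSigns v) (i : Fin p) :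
    SignType.sign (u i) = SignType.sign (v i) := by
  rw [← rootSigns_diag, ← rootSigns_diag, h]

/-- `Tuple.sort` breaks ties by index, so it depends only on the weak order of the absolute values,
which the root signs determine. -/
lemma sort_eq_of_rootSigns_eq (h : rootSigns u = rootSigns v) :
    Tuple.sort (fun j => -|u j|) = Tuple.sort (fun j => -|v j|) := by
  have hs := (Tuple.eq_sort_iff (f := fun j => -|u j|) (σ := Tuple.sort fun j => -|u j|)).1 rfl
  refine Tuple.eq_sort_iff.2 ⟨fun i j hij => ?_, fun i j hij heq => hs.2 i j hij ?_⟩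
  · have := hs.1 hij
    simp only [Function.comp_apply, neg_le_neg_iff] at this ⊢
    exact (abs_le_abs_iff_of_rootSigns_eq h _ _).1 this
  · simp only [neg_inj] at heq ⊢
    exact (abs_eq_abs_iff_of_rootSigns_eq h _ _).2 heq

lemma slopeRank_eq_of_rootSigns_eq (h : rootSigns u = rootSigns v) (i : Fin p) :
    slopeRank u i = slopeRank v i := by
  have : Nonempty (Fin p) := ⟨i⟩
  have key : ∀ w : EuclideanSpace ℝ (Fin p),
      (Finset.univ.image fun j => |w j|).filter (fun a => 0 < a ∧ a ≤ |w i|) =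
        (Finset.univ.filter fun j => 0 < |w j| ∧ |w j| ≤ |w i|).image fun j => |w j| := by
    intro w
    rw [Finset.filter_image]
  have hpos : ∀ j, 0 < |u j| ↔ 0 < |v j| := fun j => by
    rw [abs_pos, abs_pos, ← sign_ne_zero, ← sign_ne_zero (a := v j),
      sign_apply_eq_of_rootSigns_eq h]
  have hS : (Finset.univ.filter fun j => 0 < |u j| ∧ |u j| ≤ |u i|) =
      Finset.univ.filter fun j => 0 < |v j| ∧ |v j| ≤ |v i| := by
    ext j
    simp only [Finset.mem_filter, hpos j, abs_le_abs_iff_of_rootSigns_eq h j i]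
  rw [slopeRank, slopeRank, key, key, hS]
  -- The value |u j| is matched with |v j|; the choice of j attaining the value is harmless because
  -- u and v have the same ties.
  refine Finset.card_bij' (fun a _ => |v (Function.invFun (fun j => |u j|) a)|)
    (fun a _ => |u (Function.invFun (fun j => |v j|) a)|) ?_ ?_ ?_ ?_
  all_goals
    intro a ha
    obtain ⟨j, hj, rfl⟩ := Finset.mem_image.1 ha
  · have h1 : |u (Function.invFun (fun j => |u j|) |u j|)| = |u j| :=
      Function.invFun_eq (f := fun j => |u j|) ⟨j, rfl⟩
    rw [(abs_eq_abs_iff_of_rootSigns_eq h _ _).1 h1]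
    exact Finset.mem_image_of_mem _ hj
  · have h1 : |v (Function.invFun (fun j => |v j|) |v j|)| = |v j| :=
      Function.invFun_eq (f := fun j => |v j|) ⟨j, rfl⟩
    rw [(abs_eq_abs_iff_of_rootSigns_eq h _ _).2 h1]
    exact Finset.mem_image_of_mem _ hj
  · have h1 : |u (Function.invFun (fun j => |u j|) |u j|)| = |u j| :=
      Function.invFun_eq (f := fun j => |u j|) ⟨j, rfl⟩
    simp only [(abs_eq_abs_iff_of_rootSigns_eq h _ _).1 h1]
    have h2 : |v (Function.invFun (fun j => |v j|) |v j|)| = |v j| :=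
      Function.invFun_eq (f := fun j => |v j|) ⟨j, rfl⟩
    exact (abs_eq_abs_iff_of_rootSigns_eq h _ _).2 h2
  · have h1 : |v (Function.invFun (fun j => |v j|) |v j|)| = |v j| :=
      Function.invFun_eq (f := fun j => |v j|) ⟨j, rfl⟩
    simp only [(abs_eq_abs_iff_of_rootSigns_eq h _ _).2 h1]
    have h2 : |u (Function.invFun (fun j => |u j|) |u j|)| = |u j| :=
      Function.invFun_eq (f := fun j => |u j|) ⟨j, rfl⟩
    exact (abs_eq_abs_iff_of_rootSigns_eq h _ _).1 h2

lemma slopePattern_eq_of_rootSigns_eq (h : rootSigns u = rootSigns v) :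
    slopePattern u = slopePattern v := by
  ext i
  rw [slopePattern, slopePattern, slopeRank_eq_of_rootSigns_eq h,
    sign_apply_eq_of_rootSigns_eq h]

/-- This lets the false discovery proportion be read off the pattern. -/
lemma slopePattern_eq_zero_iff (u : EuclideanSpace ℝ (Fin p)) (i : Fin p) :
    slopePattern u i = 0 ↔ u i = 0 := by
  refine ⟨fun h => ?_, fun h => by simp [slopePattern, h]⟩
  by_contra hu
  rcases mul_eq_zero.1 h with h | h
  · have hmem : |u i| ∈ (Finset.univ.image fun j => |u j|).filter
        fun a => 0 < a ∧ a ≤ |u i| := by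
      simp [hu]
    have : slopeRank u i = 0 := by exact_mod_cast h
    rw [slopeRank, Finset.card_eq_zero] at this
    simp [this] at hmem
  · rcases lt_or_gt_of_ne hu with h' | h' <;> simp [h'] at h

lemma rootSigns_smul {c : ℝ} (hc : 0 < c) (u : EuclideanSpace ℝ (Fin p)) :
    rootSigns (c • u) = rootSigns u := by
  ext a
  simp [rootSigns, sign_mul, hc]

/-- For large `T`, the signs at `T • β₀ + u` are those of `β₀`, ties being broken by `u`. -/
lemma exists_forall_rootSigns_smul_add (β₀ : EuclideanSpace ℝ (Fin p)) (R : ℝ) :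
    ∃ T₀ : ℝ, 0 < T₀ ∧ ∀ T, T₀ ≤ T → ∀ u : EuclideanSpace ℝ (Fin p), ‖u‖ ≤ R →
      rootSigns (T • β₀ + u) =
        fun a => if rootSigns β₀ a = 0 then rootSigns u a else rootSigns β₀ a := by
  have key : ∀ a, ∀ᶠ T : ℝ in atTop, ∀ u : EuclideanSpace ℝ (Fin p), ‖u‖ ≤ R →
      rootSigns (T • β₀ + u) a =
        if rootSigns β₀ a = 0 then rootSigns u a else rootSigns β₀ a := by
    intro a
    by_cases h0 : signedRoot a β₀ = 0
    · refine Eventually.of_forall fun T u _ => ?_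
      simp [rootSigns, h0]
    · have hlim : Tendsto (fun T : ℝ => T * |signedRoot a β₀|) atTop atTop :=
        tendsto_id.atTop_mul_const (abs_pos.2 h0)
      -- A root functional is at most 2R in size on the ball of radius R, so beyond this threshold u
      -- cannot change a nonzero sign of β₀.
      filter_upwards [hlim.eventually_gt_atTop (2 * R), eventually_gt_atTop 0] with T hT hT0 u hu
      have hau := (abs_signedRoot_le a u).trans (by linarith : 2 * ‖u‖ ≤ 2 * R)
      have hs : rootSigns β₀ a ≠ 0 := by simpa [rootSigns] using h0
      rw [if_neg hs]
      simp only [rootSigns, map_add, map_smul, smul_eq_mul]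
      rcases lt_or_gt_of_ne h0 with h | h
      · rw [sign_neg h, sign_neg]
        rw [abs_of_neg h] at hT
        linarith [le_abs_self (signedRoot a u)]
      · rw [sign_pos h, sign_pos]
        rw [abs_of_pos h] at hT
        linarith [neg_abs_le (signedRoot a u)]
  obtain ⟨T₁, hT₁⟩ := eventually_atTop.1 (eventually_all.2 key)
  refine ⟨max T₁ 1, by positivity, fun T hT u hu => ?_⟩
  ext1 a
  exact hT₁ T ((le_max_left _ _).trans hT) a u hu

end RootSigns

/-! ### The SLOPE norm -/

/-- The linear functional that agrees with the SLOPE norm on the cone of vectors with the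
same signs as `x`. -/
noncomputable def slopeLinear {p : ℕ} (lam : Fin p → ℝ) (x v : EuclideanSpace ℝ (Fin p)) : ℝ :=
  ∑ i, lam i * ((SignType.sign (x (Tuple.sort (fun j => -|x j|) i)) : ℝ) *
    v (Tuple.sort (fun j => -|x j|) i))

section SlopeNorm

variable {p : ℕ} {lam : Fin p → ℝ}

lemma slopeLinear_self (lam : Fin p → ℝ) (u : EuclideanSpace ℝ (Fin p)) :
    slopeLinear lam u u = slopeNorm lam u := by
  simp only [slopeLinear, slopeNorm, sign_mul_self]

lemma slopeLinear_congr {x y : EuclideanSpace ℝ (Fin p)} (h : rootSigns x = rootSigns y)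
    (lam : Fin p → ℝ) (v : EuclideanSpace ℝ (Fin p)) :
    slopeLinear lam x v = slopeLinear lam y v := by
  simp only [slopeLinear, sort_eq_of_rootSigns_eq h, sign_apply_eq_of_rootSigns_eq h]

lemma slopeLinear_add (lam : Fin p → ℝ) (x v w : EuclideanSpace ℝ (Fin p)) :
    slopeLinear lam x (v + w) = slopeLinear lam x v + slopeLinear lam x w := by
  simp only [slopeLinear, PiLp.add_apply, mul_add, Finset.sum_add_distrib]

lemma slopeLinear_smul (lam : Fin p → ℝ) (x : EuclideanSpace ℝ (Fin p)) (c : ℝ)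
    (v : EuclideanSpace ℝ (Fin p)) :
    slopeLinear lam x (c • v) = c * slopeLinear lam x v := by
  simp only [slopeLinear, PiLp.smul_apply, smul_eq_mul, Finset.mul_sum]
  exact Finset.sum_congr rfl fun i _ => by ring

lemma slopeLinear_sub_weights (lam lam' : Fin p → ℝ) (x v : EuclideanSpace ℝ (Fin p)) :
    slopeLinear lam x v - slopeLinear lam' x v = slopeLinear (lam - lam') x v := by
  simp only [slopeLinear, Pi.sub_apply, sub_mul, Finset.sum_sub_distrib]

lemma abs_slopeLinear_le (lam : Fin p → ℝ) (x v : EuclideanSpace ℝ (Fin p)) :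
    |slopeLinear lam x v| ≤ (∑ i, |lam i|) * ‖v‖ := by
  rw [slopeLinear, Finset.sum_mul]
  refine (Finset.abs_sum_le_sum_abs _ _).trans (Finset.sum_le_sum fun i _ => ?_)
  rw [abs_mul, abs_mul]
  have h1 : ∀ s : SignType, |(s : ℝ)| ≤ 1 := by intro s; cases s <;> simp
  have h2 : |v (Tuple.sort (fun j => -|x j|) i)| ≤ ‖v‖ := PiLp.norm_apply_le v _
  refine mul_le_mul_of_nonneg_left ?_ (abs_nonneg _)
  calc _ ≤ 1 * ‖v‖ := mul_le_mul (h1 _) h2 (abs_nonneg _) zero_le_one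
    _ = ‖v‖ := one_mul _

/-- The rearrangement inequality: pairing decreasing weights with the decreasing absolute values is
the best pairing. With `slopeLinear_self`, this makes the norm a maximum of linear functionals,
hence convex. -/
lemma slopeLinear_le_slopeNorm (hanti : Antitone lam) (hnonneg : ∀ i, 0 ≤ lam i)
    (x v : EuclideanSpace ℝ (Fin p)) : slopeLinear lam x v ≤ slopeNorm lam v := by
  set π := Tuple.sort fun j => -|x j|
  set τ := Tuple.sort fun j => -|v j| with hτ
  have hmono : Antitone fun i => |v (τ i)| := by
    have h := Tuple.monotone_sort fun j => -|v j|
    intro i j hij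
    have := h hij
    simpa using this
  have hvary : Monovary lam fun i => |v (τ i)| := hanti.monovary hmono
  have h := hvary.sum_smul_comp_perm_le_sum_smul (σ := π.trans τ.symm)
  simp only [Equiv.trans_apply, Equiv.apply_symm_apply, smul_eq_mul] at h
  refine le_trans (Finset.sum_le_sum fun i _ => mul_le_mul_of_nonneg_left ?_ (hnonneg i)) h
  have h1 : ∀ (s : SignType) (a : ℝ), (s : ℝ) * a ≤ |a| := by
    intro s a
    cases s
    · simp
    · simpa using neg_le_abs a
    · simpa using le_abs_self a
  exact h1 _ _

lemma convexOn_slopeNorm (hanti : Antitone lam) (hnonneg : ∀ i, 0 ≤ lam i) :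
    ConvexOn ℝ Set.univ (slopeNorm lam) := by
  refine ⟨convex_univ, fun x _ y _ a b ha hb _ => ?_⟩
  rw [← slopeLinear_self, slopeLinear_add, slopeLinear_smul, slopeLinear_smul]
  exact add_le_add
    (mul_le_mul_of_nonneg_left (slopeLinear_le_slopeNorm hanti hnonneg _ _) ha)
    (mul_le_mul_of_nonneg_left (slopeLinear_le_slopeNorm hanti hnonneg _ _) hb)

lemma continuous_slopeNorm (hanti : Antitone lam) (hnonneg : ∀ i, 0 ≤ lam i) :
    Continuous (slopeNorm lam) :=
  continuousOn_univ.1 ((convexOn_slopeNorm hanti hnonneg).continuousOn isOpen_univ)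

lemma slopeNorm_smul_weights (c : ℝ) (lam : Fin p → ℝ) (β : EuclideanSpace ℝ (Fin p)) :
    slopeNorm (c • lam) β = c * slopeNorm lam β := by
  simp only [slopeNorm, Pi.smul_apply, smul_eq_mul, Finset.mul_sum, mul_assoc]

lemma slopeNorm_smul {c : ℝ} (hc : 0 < c) (lam : Fin p → ℝ) (β : EuclideanSpace ℝ (Fin p)) :
    slopeNorm lam (c • β) = c * slopeNorm lam β := by
  rw [← slopeLinear_self, slopeLinear_congr (rootSigns_smul hc β), slopeLinear_smul,
    slopeLinear_self]

/-- Along a ray the SLOPE norm is locally affine. -/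
lemma slopeNorm_smul_add (β₀ : EuclideanSpace ℝ (Fin p)) (R : ℝ) :
    ∃ T₀ : ℝ, 0 < T₀ ∧ ∀ T, T₀ ≤ T → ∀ u : EuclideanSpace ℝ (Fin p), ‖u‖ ≤ R →
      ∀ lam : Fin p → ℝ, Antitone lam → (∀ i, 0 ≤ lam i) →
      slopeNorm lam (T • β₀ + u) = slopeNorm lam (T • β₀) + slopeLinear lam (T • β₀ + u) u := by
  obtain ⟨T₀, hT₀, h⟩ := exists_forall_rootSigns_smul_add β₀ R
  refine ⟨T₀, hT₀, fun T hT u hu lam hanti hnonneg => ?_⟩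
  -- Signs are constant on the open segment, so the norm is given there by one linear functional;
  -- letting s → 0 extends the formula to the endpoint T • β₀, whose own signs may be different.
  have hs : ∀ s ∈ Set.Ioo (0 : ℝ) 1, slopeNorm lam (T • β₀ + s • u) =
      slopeLinear lam (T • β₀ + u) (T • β₀ + s • u) := by
    intro s hs
    have hsu : ‖s • u‖ ≤ R := by
      rw [norm_smul, Real.norm_of_nonneg hs.1.le]
      exact (mul_le_of_le_one_left (norm_nonneg _) hs.2.le).trans hu
    rw [← slopeLinear_self]
    refine slopeLinear_congr ?_ _ _
    rw [h T hT _ hsu, h T hT u hu, rootSigns_smul hs.1]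
  have hev : ∀ᶠ s in 𝓝[>] (0 : ℝ), slopeNorm lam (T • β₀ + s • u) =
      slopeLinear lam (T • β₀ + u) (T • β₀) + s * slopeLinear lam (T • β₀ + u) u := by
    filter_upwards [Ioo_mem_nhdsGT (zero_lt_one (α := ℝ))] with s hs'
    rw [hs s hs', slopeLinear_add, slopeLinear_smul _ _ s]
  have h1 : Tendsto (fun s : ℝ => slopeNorm lam (T • β₀ + s • u)) (𝓝[>] 0)
      (𝓝 (slopeNorm lam (T • β₀))) := by
    have hc : Continuous fun s : ℝ => slopeNorm lam (T • β₀ + s • u) :=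
      (continuous_slopeNorm hanti hnonneg).comp (by fun_prop)
    have := hc.tendsto 0
    simp only [zero_smul, add_zero] at this
    exact this.mono_left nhdsWithin_le_nhds
  have h2 : Tendsto (fun s : ℝ => slopeLinear lam (T • β₀ + u) (T • β₀) +
      s * slopeLinear lam (T • β₀ + u) u) (𝓝[>] 0)
      (𝓝 (slopeLinear lam (T • β₀ + u) (T • β₀))) := by
    have hc : Continuous fun s : ℝ => slopeLinear lam (T • β₀ + u) (T • β₀) +
      s * slopeLinear lam (T • β₀ + u) u := by fun_prop
    have := hc.tendsto 0
    simp only [zero_mul, add_zero] at this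
    exact this.mono_left nhdsWithin_le_nhds
  have heq := tendsto_nhds_unique (h1.congr' hev) h2
  rw [heq, ← slopeLinear_self lam (T • β₀ + u), slopeLinear_add]

end SlopeNorm

/-! ### The directional derivative of the SLOPE norm -/

section DirectionalDerivative

variable {p : ℕ} {lam : Fin p → ℝ}

/-- On bounded sets, the SLOPE norm around `T • β₀` agrees with its directional derivative, and
the pattern with the limiting pattern, as soon as `T` is large. -/
lemma exists_forall_slopeNorm_eq_add_slopeDirDeriv (β₀ : EuclideanSpace ℝ (Fin p)) (R : ℝ) :
    ∃ T₀ : ℝ, 0 < T₀ ∧ ∀ T, T₀ ≤ T → ∀ u : EuclideanSpace ℝ (Fin p), ‖u‖ ≤ R →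
      limitingPattern β₀ u = slopePattern (T • β₀ + u) ∧
      ∀ lam : Fin p → ℝ, Antitone lam → (∀ i, 0 ≤ lam i) →
        slopeNorm lam (T • β₀ + u) = slopeNorm lam (T • β₀) + slopeDirDeriv lam β₀ u ∧
        slopeDirDeriv lam β₀ u = slopeLinear lam (T • β₀ + u) u := by
  obtain ⟨T₁, hT₁, h₁⟩ := exists_forall_rootSigns_smul_add β₀ R
  obtain ⟨T₂, hT₂, h₂⟩ := slopeNorm_smul_add β₀ R
  refine ⟨max T₁ T₂, by positivity, fun T hT u hu => ?_⟩
  have hTle := max_le_iff.1 hT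
  -- Here t⁻¹ plays the role of T: β₀ + tu = t(t⁻¹β₀ + u), and positive scaling preserves signs.
  have hsmall : ∀ᶠ t in 𝓝[>] (0 : ℝ), 0 < t ∧ max T₁ T₂ ≤ t⁻¹ :=
    (eventually_mem_nhdsWithin).and
      (tendsto_inv_nhdsGT_zero.eventually_ge_atTop _)
  have hscale : ∀ t : ℝ, 0 < t → β₀ + t • u = t • (t⁻¹ • β₀ + u) := fun t ht => by
    rw [smul_add, smul_smul, mul_inv_cancel₀ ht.ne', one_smul]
  have hsigns : ∀ t : ℝ, 0 < t → max T₁ T₂ ≤ t⁻¹ →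
      rootSigns (t⁻¹ • β₀ + u) = rootSigns (T • β₀ + u) := fun t ht ht' => by
    rw [h₁ _ ((le_max_left _ _).trans ht') u hu, h₁ _ hTle.1 u hu]
  have hpatt : limitingPattern β₀ u = slopePattern (T • β₀ + u) := by
    refine Tendsto.limUnder_eq (tendsto_const_nhds.congr' ?_)
    filter_upwards [hsmall] with t ht
    rw [hscale t ht.1]
    refine (slopePattern_eq_of_rootSigns_eq ?_).symm
    rw [rootSigns_smul ht.1, hsigns t ht.1 ht.2]
  refine ⟨hpatt, fun lam hanti hnonneg => ?_⟩
  have hderiv : slopeDirDeriv lam β₀ u = slopeLinear lam (T • β₀ + u) u := by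
    refine Tendsto.limUnder_eq (tendsto_const_nhds.congr' ?_)
    filter_upwards [hsmall] with t ht
    have hβ : β₀ = t • (t⁻¹ • β₀) := by rw [smul_smul, mul_inv_cancel₀ ht.1.ne', one_smul]
    have hN : slopeNorm lam β₀ = t * slopeNorm lam (t⁻¹ • β₀) := by
      rw [← slopeNorm_smul ht.1, ← hβ]
    rw [hscale t ht.1, slopeNorm_smul ht.1, hN,
      h₂ _ ((le_max_right _ _).trans ht.2) u hu lam hanti hnonneg,
      slopeLinear_congr (hsigns t ht.1 ht.2)]
    field_simp [ht.1.ne']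
    ring
  exact ⟨by rw [hderiv, ← h₂ T hTle.2 u hu lam hanti hnonneg], hderiv⟩

lemma limitingPattern_eq_of_rootSigns_eq (β₀ : EuclideanSpace ℝ (Fin p))
    {u v : EuclideanSpace ℝ (Fin p)} (h : rootSigns u = rootSigns v) :
    limitingPattern β₀ u = limitingPattern β₀ v := by
  obtain ⟨T₁, hT₁, h₁⟩ := exists_forall_rootSigns_smul_add β₀ (max ‖u‖ ‖v‖)
  obtain ⟨T₂, hT₂, h₂⟩ := exists_forall_slopeNorm_eq_add_slopeDirDeriv β₀ (max ‖u‖ ‖v‖)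
  rw [(h₂ (max T₁ T₂) (le_max_right _ _) u (le_max_left _ _)).1,
    (h₂ (max T₁ T₂) (le_max_right _ _) v (le_max_right _ _)).1]
  refine slopePattern_eq_of_rootSigns_eq ?_
  rw [h₁ _ (le_max_left _ _) u (le_max_left _ _), h₁ _ (le_max_left _ _) v (le_max_right _ _), h]

/-- On one sign cell the tie-broken signs of Tβ₀ + u do not vary, so one base point x represents the
derivative as a linear functional there. It serves all weights at once, as needed when the weights
vary with n. -/
lemma exists_forall_slopeDirDeriv_eq_slopeLinear (β₀ : EuclideanSpace ℝ (Fin p))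
    (σ : Fin p × Fin p × Bool → SignType) :
    ∃ x : EuclideanSpace ℝ (Fin p), ∀ u, rootSigns u = σ →
      ∀ lam : Fin p → ℝ, Antitone lam → (∀ i, 0 ≤ lam i) →
        slopeDirDeriv lam β₀ u = slopeLinear lam x u := by
  by_cases hσ : ∃ u₀ : EuclideanSpace ℝ (Fin p), rootSigns u₀ = σ
  · obtain ⟨u₀, hu₀⟩ := hσ
    obtain ⟨T₀, -, h₀⟩ := exists_forall_rootSigns_smul_add β₀ ‖u₀‖
    refine ⟨T₀ • β₀ + u₀, fun u hu lam hanti hnonneg => ?_⟩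
    obtain ⟨T₁, hT₁, h₁⟩ := exists_forall_rootSigns_smul_add β₀ ‖u‖
    obtain ⟨T₂, hT₂, h₂⟩ := exists_forall_slopeNorm_eq_add_slopeDirDeriv β₀ ‖u‖
    rw [((h₂ (max T₁ T₂) (le_max_right _ _) u le_rfl).2 lam hanti hnonneg).2]
    refine slopeLinear_congr ?_ _ _
    rw [h₁ _ (le_max_left _ _) u le_rfl, h₀ _ le_rfl u₀ le_rfl, hu, hu₀]
  · exact ⟨0, fun u hu => (hσ ⟨u, hu⟩).elim⟩

/-- For one large T, the derivative at the three points involved is a translate of the norm minus a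
constant, so convexity is inherited. -/
lemma convexOn_slopeDirDeriv (hanti : Antitone lam) (hnonneg : ∀ i, 0 ≤ lam i)
    (β₀ : EuclideanSpace ℝ (Fin p)) : ConvexOn ℝ Set.univ (slopeDirDeriv lam β₀) := by
  refine ⟨convex_univ, fun x _ y _ a b ha hb hab => ?_⟩
  obtain ⟨T, hT, h⟩ := exists_forall_slopeNorm_eq_add_slopeDirDeriv β₀
    (max ‖a • x + b • y‖ (max ‖x‖ ‖y‖))
  have hc := (convexOn_slopeNorm hanti hnonneg).2 (Set.mem_univ (T • β₀ + x))
    (Set.mem_univ (T • β₀ + y)) ha hb hab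
  have hcomb : a • (T • β₀ + x) + b • (T • β₀ + y) = T • β₀ + (a • x + b • y) := by
    have : T • β₀ = a • (T • β₀) + b • (T • β₀) := by rw [← add_smul, hab, one_smul]
    nth_rw 3 [this]
    simp only [smul_add]
    abel
  rw [hcomb, ((h T le_rfl _ (le_max_left _ _)).2 lam hanti hnonneg).1,
    ((h T le_rfl x ((le_max_left _ _).trans (le_max_right _ _))).2 lam hanti hnonneg).1,
    ((h T le_rfl y ((le_max_right _ _).trans (le_max_right _ _))).2 lam hanti hnonneg).1] at hc
  simp only [smul_eq_mul] at hc ⊢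
  have : slopeNorm lam (T • β₀) = a * slopeNorm lam (T • β₀) + b * slopeNorm lam (T • β₀) := by
    rw [← add_mul, hab, one_mul]
  linarith

lemma continuous_slopeDirDeriv (hanti : Antitone lam) (hnonneg : ∀ i, 0 ≤ lam i)
    (β₀ : EuclideanSpace ℝ (Fin p)) : Continuous (slopeDirDeriv lam β₀) :=
  continuousOn_univ.1 ((convexOn_slopeDirDeriv hanti hnonneg β₀).continuousOn isOpen_univ)

lemma abs_slopeDirDeriv_le (hanti : Antitone lam) (hnonneg : ∀ i, 0 ≤ lam i)
    (β₀ u : EuclideanSpace ℝ (Fin p)) :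
    |slopeDirDeriv lam β₀ u| ≤ (∑ i, |lam i|) * ‖u‖ := by
  obtain ⟨x, hx⟩ := exists_forall_slopeDirDeriv_eq_slopeLinear β₀ (rootSigns u)
  rw [hx u rfl lam hanti hnonneg]
  exact abs_slopeLinear_le _ _ _

lemma abs_slopeDirDeriv_sub_le {lam' : Fin p → ℝ} (hanti : Antitone lam)
    (hnonneg : ∀ i, 0 ≤ lam i) (hanti' : Antitone lam') (hnonneg' : ∀ i, 0 ≤ lam' i)
    (β₀ u : EuclideanSpace ℝ (Fin p)) :
    |slopeDirDeriv lam β₀ u - slopeDirDeriv lam' β₀ u| ≤ (∑ i, |lam i - lam' i|) * ‖u‖ := by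
  obtain ⟨x, hx⟩ := exists_forall_slopeDirDeriv_eq_slopeLinear β₀ (rootSigns u)
  rw [hx u rfl lam hanti hnonneg, hx u rfl lam' hanti' hnonneg', slopeLinear_sub_weights]
  exact abs_slopeLinear_le _ _ _

end DirectionalDerivative

/-! ### Stability of minimisers of convex functions -/

/-- If convex functions converge locally uniformly to a continuous function with a unique
minimiser, then their minimisers converge to it. -/
lemma tendsto_of_isMinOn_of_convexOn {E : Type*} [NormedAddCommGroup E] [NormedSpace ℝ E]
    [ProperSpace E] {Q : E → ℝ} (hQ : Continuous Q) {x : E} (hx : ∀ y, y ≠ x → Q x < Q y)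
    {F : ℕ → E → ℝ} (hF : ∀ k, ConvexOn ℝ Set.univ (F k))
    (hlim : ∀ R ε : ℝ, 0 < ε → ∀ᶠ k in atTop, ∀ y, ‖y‖ ≤ R → |F k y - Q y| ≤ ε)
    {y : ℕ → E} (hy : ∀ k, IsMinOn (F k) Set.univ (y k)) : Tendsto y atTop (𝓝 x) := by
  rw [Metric.tendsto_nhds]
  intro ε hε
  obtain ⟨δ, hδ, hsphere⟩ : ∃ δ > 0, ∀ z ∈ Metric.sphere x ε, Q x + δ ≤ Q z := by
    rcases (Metric.sphere x ε).eq_empty_or_nonempty with h | h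
    · exact ⟨1, one_pos, by simp [h]⟩
    · obtain ⟨z, hz, hmin⟩ := (isCompact_sphere x ε).exists_isMinOn h hQ.continuousOn
      have hzx : z ≠ x := by
        rintro rfl
        simp [hε.ne] at hz
      exact ⟨Q z - Q x, sub_pos.2 (hx z hzx), fun z' hz' => by
        have : Q z ≤ Q z' := hmin hz'
        linarith⟩
  filter_upwards [hlim (‖x‖ + ε) (δ / 3) (by positivity)] with k hk
  by_contra hdist
  rw [not_lt] at hdist
  set d := dist (y k) x with hd
  have hd0 : 0 < d := hε.trans_le hdist
  -- The point z of the segment from x to `y k` lies at distance ε from x. Convexity gives F z ≤ F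
  -- x, whereas the gap δ on the sphere with two errors δ/3 forces F z > F x.
  set s := ε / d with hs
  have hs0 : 0 ≤ s := by positivity
  have hs1 : s ≤ 1 := (div_le_one hd0).2 hdist
  set z := (1 - s) • x + s • y k with hz
  have hzx : z - x = s • (y k - x) := by
    rw [hz, smul_sub, sub_smul, one_smul]
    abel
  have hzmem : z ∈ Metric.sphere x ε := by
    rw [mem_sphere_iff_norm, hzx, norm_smul, Real.norm_of_nonneg hs0, ← dist_eq_norm, ← hd, hs,
      div_mul_cancel₀ _ hd0.ne']
  have hznorm : ‖z‖ ≤ ‖x‖ + ε := by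
    have : z = x + (z - x) := by abel
    rw [this]
    refine (norm_add_le _ _).trans ?_
    rw [mem_sphere_iff_norm] at hzmem
    rw [hzmem]
  have hconv := (hF k).2 (Set.mem_univ x) (Set.mem_univ (y k)) (sub_nonneg.2 hs1) hs0 (by ring)
  rw [← hz] at hconv
  have hmin : F k (y k) ≤ F k x := hy k (Set.mem_univ x)
  have h1 := abs_le.1 (hk z hznorm)
  have h2 := abs_le.1 (hk x (by linarith))
  have h3 := hsphere z hzmem
  simp only [smul_eq_mul] at hconv
  nlinarith [mul_le_mul_of_nonneg_left hmin hs0]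

section Quadratic

variable {E : Type*} [NormedAddCommGroup E] [InnerProductSpace ℝ E]
  {A : E →L[ℝ] E} {c M : ℝ} {h : E → ℝ}

/-- A coercive quadratic function plus a convex function of at most linear growth has a unique
minimiser. -/
lemma exists_unique_minimizer [FiniteDimensional ℝ E] (hA : ∀ u v, inner ℝ (A u) v = inner ℝ u (A v))
    (hc : 0 < c) (hAc : ∀ u, c * ‖u‖ ^ 2 ≤ inner ℝ u (A u))
    (hconv : ConvexOn ℝ Set.univ h) (hM : ∀ u, |h u| ≤ M * ‖u‖) (w : E) :
    ∃ x : E, ∀ y, y ≠ x → 1 / 2 * inner ℝ x (A x) - inner ℝ x w + h x <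
      1 / 2 * inner ℝ y (A y) - inner ℝ y w + h y := by
  have hcont : Continuous h := continuousOn_univ.1 (hconv.continuousOn isOpen_univ)
  set Q : E → ℝ := fun u => 1 / 2 * inner ℝ u (A u) - inner ℝ u w + h u with hQ
  have hQc : Continuous Q := by fun_prop
  have hcoer : ∀ᶠ u in cocompact E, Q 0 ≤ Q u := by
    have hlim : Tendsto (fun u : E => ‖u‖) (cocompact E) atTop := tendsto_norm_cocompact_atTop
    -- Beyond this radius (c/2)‖u‖² dominates the terms of linear growth.
    filter_upwards [hlim.eventually_ge_atTop (2 * (‖w‖ + M) / c), hlim.eventually_ge_atTop 0]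
      with u hu hu0
    have h0 : h 0 = 0 := by
      have := hM 0
      simpa using this
    have h1 := hAc u
    have h2 := (abs_le.1 (hM u)).1
    have h3 := real_inner_le_norm u w
    rw [div_le_iff₀ hc] at hu
    have : Q 0 = 0 := by simp [hQ, h0]
    rw [this]
    simp only [hQ]
    nlinarith [mul_le_mul_of_nonneg_right hu hu0]
  obtain ⟨x, hx⟩ := hQc.exists_forall_le' 0 hcoer
  refine ⟨x, fun y hyx => ?_⟩
  by_contra hle
  rw [not_lt] at hle
  -- At the midpoint the quadratic part lies below the average by ⅛⟨y − x, A(y − x)⟩ > 0, so a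
  -- second minimiser would contradict minimality of x.
  have hmid := hx ((1 / 2 : ℝ) • x + (1 / 2 : ℝ) • y)
  have hch := hconv.2 (Set.mem_univ x) (Set.mem_univ y) (by norm_num : (0 : ℝ) ≤ 1 / 2)
    (by norm_num : (0 : ℝ) ≤ 1 / 2) (by norm_num)
  have hpos : 0 < c * ‖y - x‖ ^ 2 := by
    have := norm_pos_iff.2 (sub_ne_zero.2 hyx)
    positivity
  have hq := hAc (y - x)
  have hsym : inner ℝ y (A x) = inner ℝ x (A y) := by rw [← hA, real_inner_comm]
  simp only [hQ, map_add, map_smul, map_sub, inner_add_left, inner_add_right, inner_sub_left,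
    inner_sub_right, real_inner_smul_left, real_inner_smul_right, smul_eq_mul] at hmid hch hq hle
  linarith

end Quadratic

/-! ### Stability of the pattern -/

/-- The vectors on which every functional `u ↦ u_i ± u_j` of sign zero in `σ` vanishes. -/
def signSubspace {p : ℕ} (σ : Fin p × Fin p × Bool → SignType) :
    Submodule ℝ (EuclideanSpace ℝ (Fin p)) where
  carrier := {v | ∀ a, σ a = 0 → signedRoot a v = 0}
  add_mem' hv hw a ha := by rw [map_add, hv a ha, hw a ha, add_zero]
  zero_mem' a _ := map_zero _
  smul_mem' c v hv a ha := by rw [map_smul, hv a ha, smul_zero]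

section PatternStability

variable {p : ℕ} {A : EuclideanSpace ℝ (Fin p) →L[ℝ] EuclideanSpace ℝ (Fin p)}
  {w u : EuclideanSpace ℝ (Fin p)}

lemma mem_signSubspace_rootSigns (u : EuclideanSpace ℝ (Fin p)) :
    u ∈ signSubspace (rootSigns u) := fun a ha => by
  simpa [rootSigns] using ha

/-- Zero signs stay zero because v is in the subspace; nonzero signs are stable under small
perturbations. -/
lemma eventually_rootSigns_add_smul (u : EuclideanSpace ℝ (Fin p))
    {v : EuclideanSpace ℝ (Fin p)} (hv : v ∈ signSubspace (rootSigns u)) :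
    ∀ᶠ t in 𝓝 (0 : ℝ), rootSigns (u + t • v) = rootSigns u := by
  have key : ∀ a, ∀ᶠ t in 𝓝 (0 : ℝ), rootSigns (u + t • v) a = rootSigns u a := by
    intro a
    by_cases ha : rootSigns u a = 0
    · refine Eventually.of_forall fun t => ?_
      simp only [rootSigns, map_add, map_smul, hv a ha, smul_zero, add_zero]
    · have hcont : ContinuousAt (fun t : ℝ => signedRoot a (u + t • v)) 0 := by fun_prop
      have hne : signedRoot a u ≠ 0 := by simpa [rootSigns] using ha
      have h0 : Tendsto (fun t : ℝ => signedRoot a (u + t • v)) (𝓝 0) (𝓝 (signedRoot a u)) := by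
        simpa using hcont.tendsto
      rcases lt_or_gt_of_ne hne with h | h
      · filter_upwards [h0.eventually_lt_const h] with t ht
        simp only [rootSigns, sign_neg ht, sign_neg h]
      · filter_upwards [h0.eventually_const_lt h] with t ht
        simp only [rootSigns, sign_pos ht, sign_pos h]
  filter_upwards [eventually_all.2 key] with t ht
  exact funext ht

/-- The first-order condition that survives in the limit when all approximating minimisers have
the same signs. -/
lemma inner_eq_of_tendsto_isMinOn (hA : ∀ u v, inner ℝ (A u) v = inner ℝ u (A v))
    {β₀ : EuclideanSpace ℝ (Fin p)} {lam : Fin p → ℝ} {μ : ℕ → Fin p → ℝ}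
    (hμ_anti : ∀ k, Antitone (μ k)) (hμ_nonneg : ∀ k i, 0 ≤ μ k i)
    (hμ : Tendsto μ atTop (𝓝 lam)) {f : ℕ → EuclideanSpace ℝ (Fin p) → ℝ}
    (hf : ∀ k, ConvexOn ℝ Set.univ (f k))
    (hlim : ∀ R ε : ℝ, 0 < ε → ∀ᶠ k in atTop, ∀ y, ‖y‖ ≤ R →
      |f k y - (1 / 2 * inner ℝ y (A y) - inner ℝ y w)| ≤ ε)
    {uk : ℕ → EuclideanSpace ℝ (Fin p)} (huk : Tendsto uk atTop (𝓝 u))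
    (hmin : ∀ k, IsMinOn (fun y => f k y + slopeDirDeriv (μ k) β₀ y) Set.univ (uk k))
    {σ : Fin p × Fin p × Bool → SignType} (hσ : ∀ k, rootSigns (uk k) = σ)
    {x : EuclideanSpace ℝ (Fin p)} (hx : ∀ u, rootSigns u = σ →
      ∀ lam : Fin p → ℝ, Antitone lam → (∀ i, 0 ≤ lam i) →
        slopeDirDeriv lam β₀ u = slopeLinear lam x u)
    {v : EuclideanSpace ℝ (Fin p)} (hv : v ∈ signSubspace σ) :
    inner ℝ v w = inner ℝ v (A u) + slopeLinear lam x v := by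
  -- Near t = 0 the line stays in one sign cell, where the penalty is affine. Replacing the penalty
  -- by its affine form gives a convex function of t with a local, hence global, minimum at 0, an
  -- inequality that survives the limit for all t.
  have hglobal : ∀ k (t : ℝ), f k (uk k) ≤ f k (uk k + t • v) + t * slopeLinear (μ k) x v := by
    intro k t
    have hloc : IsLocalMin (fun t : ℝ => f k (uk k + t • v) + t * slopeLinear (μ k) x v) 0 := by
      filter_upwards [eventually_rootSigns_add_smul (uk k) (by rwa [hσ k])] with s hs
      have h1 : f k (uk k) + slopeDirDeriv (μ k) β₀ (uk k) ≤
          f k (uk k + s • v) + slopeDirDeriv (μ k) β₀ (uk k + s • v) :=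
        hmin k (Set.mem_univ (uk k + s • v))
      rw [hx _ (hs.trans (hσ k)) _ (hμ_anti k) (hμ_nonneg k),
        hx _ (hσ k) _ (hμ_anti k) (hμ_nonneg k), slopeLinear_add, slopeLinear_smul] at h1
      simp only [zero_smul, add_zero, zero_mul]
      linarith
    have hconv : ConvexOn ℝ Set.univ
        (fun t : ℝ => f k (uk k + t • v) + t * slopeLinear (μ k) x v) := by
      refine ⟨convex_univ, fun a _ b _ r s hr hs hrs => ?_⟩
      have h1 := (hf k).2 (Set.mem_univ (uk k + a • v)) (Set.mem_univ (uk k + b • v)) hr hs hrs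
      have hcomb : r • (uk k + a • v) + s • (uk k + b • v) = uk k + (r • a + s • b) • v := by
        have : uk k = r • uk k + s • uk k := by rw [← add_smul, hrs, one_smul]
        nth_rw 3 [this]
        simp only [smul_add, add_smul, smul_smul, smul_eq_mul]
        abel
      rw [hcomb] at h1
      simp only [smul_eq_mul] at h1 ⊢
      linarith
    have := IsMinOn.of_isLocalMin_of_convex_univ hloc hconv t
    simpa using this
  have hconvg : ∀ z : EuclideanSpace ℝ (Fin p), Tendsto (fun k => f k (uk k + z)) atTop
      (𝓝 (1 / 2 * inner ℝ (u + z) (A (u + z)) - inner ℝ (u + z) w)) := by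
    intro z
    set q : EuclideanSpace ℝ (Fin p) → ℝ := fun y => 1 / 2 * inner ℝ y (A y) - inner ℝ y w
    have hq : Continuous q := by fun_prop
    have huz : Tendsto (fun k => uk k + z) atTop (𝓝 (u + z)) := huk.add_const z
    have h1 : Tendsto (fun k => q (uk k + z)) atTop (𝓝 (q (u + z))) :=
      (hq.tendsto _).comp huz
    have h2 : Tendsto (fun k => f k (uk k + z) - q (uk k + z)) atTop (𝓝 0) := by
      rw [Metric.tendsto_nhds]
      intro ε hε
      have hb : ∀ᶠ k in atTop, ‖uk k + z‖ < ‖u + z‖ + 1 :=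
        huz.norm.eventually_lt_const (by linarith)
      filter_upwards [hlim (‖u + z‖ + 1) (ε / 2) (by positivity), hb] with k hk hbk
      rw [Real.dist_eq, sub_zero]
      exact (hk _ hbk.le).trans_lt (by linarith)
    have := h2.add h1
    simpa only [sub_add_cancel, zero_add] using this
  have hlin : Tendsto (fun k => slopeLinear (μ k) x v) atTop (𝓝 (slopeLinear lam x v)) := by
    refine tendsto_finsetSum _ fun i _ => ?_
    exact ((tendsto_pi_nhds.1 hμ i).mul_const _)
  have hlimit : ∀ t : ℝ, 0 ≤ t * (inner ℝ v (A u) - inner ℝ v w + slopeLinear lam x v) +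
      t ^ 2 * (1 / 2 * inner ℝ v (A v)) := by
    intro t
    have h1 := le_of_tendsto_of_tendsto' (by simpa using hconvg 0)
      ((hconvg (t • v)).add (hlin.const_mul t)) fun k => hglobal k t
    have hsym : inner ℝ u (A v) = inner ℝ v (A u) := by rw [← hA, real_inner_comm]
    simp only [map_add, map_smul, inner_add_left, inner_add_right, real_inner_smul_left,
      real_inner_smul_right, hsym] at h1
    linarith
  set b := inner ℝ v (A u) - inner ℝ v w + slopeLinear lam x v with hb
  set d := 1 / 2 * inner ℝ v (A v) with hd
  have hb0 : b = 0 := by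
    by_contra hne
    have hd1 : 0 < |d| + 1 := by positivity
    -- A step against the slope b, short enough that the quadratic term cannot compensate, even if d
    -- is large.
    have h1 := hlimit (-b / (|d| + 1))
    have h2 : -b / (|d| + 1) * b + (-b / (|d| + 1)) ^ 2 * d =
        b ^ 2 / (|d| + 1) ^ 2 * (d - |d| - 1) := by
      field_simp
      ring
    rw [h2] at h1
    have h3 : 0 < b ^ 2 / (|d| + 1) ^ 2 := by positivity
    nlinarith [le_abs_self d]
  linarith

/-- When the law of `w` charges no hyperplane, approximate minimisers almost surely have the
same signs as the limiting minimiser. -/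
theorem ae_eventually_rootSigns_eq (hA : ∀ u v, inner ℝ (A u) v = inner ℝ u (A v))
    (β₀ : EuclideanSpace ℝ (Fin p)) (lam : Fin p → ℝ)
    (ν : Measure (EuclideanSpace ℝ (Fin p)))
    (hν : ∀ (v : EuclideanSpace ℝ (Fin p)) (b : ℝ), v ≠ 0 → ν {w | inner ℝ v w = b} = 0) :
    ∀ᵐ w ∂ν, ∀ (u : EuclideanSpace ℝ (Fin p)) (μ : ℕ → Fin p → ℝ)
      (f : ℕ → EuclideanSpace ℝ (Fin p) → ℝ) (uk : ℕ → EuclideanSpace ℝ (Fin p)),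
      (∀ k, Antitone (μ k)) → (∀ k i, 0 ≤ μ k i) → Tendsto μ atTop (𝓝 lam) →
      (∀ k, ConvexOn ℝ Set.univ (f k)) →
      (∀ R ε : ℝ, 0 < ε → ∀ᶠ k in atTop, ∀ y, ‖y‖ ≤ R →
        |f k y - (1 / 2 * inner ℝ y (A y) - inner ℝ y w)| ≤ ε) →
      Tendsto uk atTop (𝓝 u) →
      (∀ᶠ k in atTop, IsMinOn (fun y => f k y + slopeDirDeriv (μ k) β₀ y) Set.univ (uk k)) →
      ∀ᶠ k in atTop, rootSigns (uk k) = rootSigns u := by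
  choose x hx using exists_forall_slopeDirDeriv_eq_slopeLinear β₀
  have hexists : ∀ σ τ : Fin p × Fin p × Bool → SignType, ∃ v : EuclideanSpace ℝ (Fin p),
      signSubspace τ < signSubspace σ → v ≠ 0 ∧ v ∈ signSubspace σ ∧
        ∀ u ∈ signSubspace τ, inner ℝ v (A u) = 0 := by
    intro σ τ
    by_cases hlt : signSubspace τ < signSubspace σ
    -- Pairing through A sends the larger space to the dual of the smaller, so it has a nonzero
    -- kernel vector.
    · let B : signSubspace σ →ₗ[ℝ] Module.Dual ℝ (signSubspace τ) :=
        LinearMap.mk₂ ℝ (fun v u => inner ℝ (v : EuclideanSpace ℝ (Fin p)) (A u))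
          (fun a b c => by simp [inner_add_left]) (fun r a c => by simp [real_inner_smul_left])
          (fun a b c => by simp [inner_add_right]) (fun r a c => by simp [real_inner_smul_right])
      have hker : LinearMap.ker B ≠ ⊥ := B.ker_ne_bot_of_finrank_lt <| by
        rw [Subspace.dual_finrank_eq]
        exact Submodule.finrank_lt_finrank_of_lt hlt
      obtain ⟨v, hv, hv0⟩ := Submodule.exists_mem_ne_zero_of_ne_bot hker
      refine ⟨v, fun _ => ⟨by simpa using hv0, v.2, fun u hu => ?_⟩⟩
      have := LinearMap.congr_fun (LinearMap.mem_ker.1 hv) ⟨u, hu⟩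
      simpa [B] using this
    · exact ⟨0, fun h => (hlt h).elim⟩
  choose V hV using hexists
  have hnull : ∀ᵐ w ∂ν, ∀ σ τ : Fin p × Fin p × Bool → SignType,
      signSubspace τ < signSubspace σ → inner ℝ (V σ τ) w ≠ slopeLinear lam (x σ) (V σ τ) := by
    rw [ae_all_iff]
    intro σ
    rw [ae_all_iff]
    intro τ
    by_cases hlt : signSubspace τ < signSubspace σ
    · rw [ae_iff]
      refine measure_mono_null ?_ (hν (V σ τ) (slopeLinear lam (x σ) (V σ τ)) (hV σ τ hlt).1)
      intro w hw
      by_contra hne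
      exact hw fun _ => hne
    · exact Eventually.of_forall fun w h => (hlt h).elim
  filter_upwards [hnull] with w hw u μ f uk hμ_anti hμ_nonneg hμ hf hlim huk hmin
  by_contra hnot
  rw [not_eventually] at hnot
  -- There are finitely many sign vectors, so a wrong one recurs infinitely often.
  obtain ⟨σ, hσu, hσ⟩ : ∃ σ, σ ≠ rootSigns u ∧ ∃ᶠ k in atTop, rootSigns (uk k) = σ := by
    by_contra hcon
    push Not at hcon
    refine hnot ?_
    have : ∀ σ : Fin p × Fin p × Bool → SignType, ∀ᶠ k in atTop,
        σ ≠ rootSigns u → rootSigns (uk k) ≠ σ := fun σ => by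
      by_cases h : σ = rootSigns u
      · exact Eventually.of_forall fun k h' => (h' h).elim
      · filter_upwards [hcon σ h] with k hk _ using hk
    filter_upwards [eventually_all.2 this] with k hk hk'
    exact hk _ hk' rfl
  obtain ⟨φ, hφ, hφ'⟩ := extraction_of_frequently_atTop (hσ.and_eventually hmin)
  have hφt := hφ.tendsto_atTop
  have huφ : Tendsto (fun k => uk (φ k)) atTop (𝓝 u) := huk.comp hφt
  have hzero : ∀ a, σ a = 0 → signedRoot a u = 0 := by
    intro a ha
    have h1 : Tendsto (fun k => signedRoot a (uk (φ k))) atTop (𝓝 (signedRoot a u)) :=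
      ((signedRoot a).continuous.tendsto u).comp huφ
    have h2 : ∀ k, signedRoot a (uk (φ k)) = 0 := fun k => by
      have h3 := congrFun (hφ' k).1 a
      rw [ha] at h3
      simpa [rootSigns] using h3
    simp only [h2] at h1
    exact tendsto_nhds_unique h1 tendsto_const_nhds |>.symm ▸ rfl
  obtain ⟨a, haσ, hau⟩ : ∃ a, σ a ≠ 0 ∧ signedRoot a u = 0 := by
    by_contra hcon
    push Not at hcon
    refine hσu (funext fun a => ?_)
    by_cases ha : σ a = 0
    · simp [ha, rootSigns, hzero a ha]
    · have hne := hcon a ha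
      have h1 : Tendsto (fun k => signedRoot a (uk (φ k))) atTop (𝓝 (signedRoot a u)) :=
        ((signedRoot a).continuous.tendsto u).comp huφ
      have h2 : ∀ k, SignType.sign (signedRoot a (uk (φ k))) = σ a := fun k =>
        congrFun (hφ' k).1 a
      rcases lt_or_gt_of_ne hne with h | h
      · obtain ⟨k, hk⟩ := (h1.eventually_lt_const h).exists
        rw [← h2 k, rootSigns, sign_neg hk, sign_neg h]
      · obtain ⟨k, hk⟩ := (h1.eventually_const_lt h).exists
        rw [← h2 k, rootSigns, sign_pos hk, sign_pos h]
  have hlt : signSubspace (rootSigns u) < signSubspace σ := by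
    refine lt_of_le_of_ne (fun v hv b hb => hv b ?_) fun heq => ?_
    · simp [rootSigns, hzero b hb]
    · have hmem : uk (φ 0) ∈ signSubspace (rootSigns u) := by
        rw [heq, ← (hφ' 0).1]
        exact mem_signSubspace_rootSigns _
      have h1 := hmem a (by simp [rootSigns, hau])
      refine haσ ?_
      rw [← (hφ' 0).1, rootSigns, h1, sign_zero]
  obtain ⟨-, hVσ, hVτ⟩ := hV σ (rootSigns u) hlt
  refine hw σ (rootSigns u) hlt ?_
  rw [inner_eq_of_tendsto_isMinOn hA (fun k => hμ_anti (φ k)) (fun k => hμ_nonneg (φ k))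
    (hμ.comp hφt) (fun k => hf (φ k)) (fun R ε hε => hφt.eventually (hlim R ε hε)) huφ
    (fun k => (hφ' k).2) (fun k => (hφ' k).1) (hx σ) hVσ,
    hVτ u (mem_signSubspace_rootSigns u), zero_add]

end PatternStability

/-! ### The Hessian at a minimiser -/

section Hessian

variable {p : ℕ} {G : EuclideanSpace ℝ (Fin p) → ℝ} {C : Matrix (Fin p) (Fin p) ℝ}
  {β₀ : EuclideanSpace ℝ (Fin p)}

/-- Symmetry of the second derivative; it is not part of the definition of `HasHessianAt`. -/
lemma HasHessianAt.inner_comm (h : HasHessianAt G C β₀) (u v : EuclideanSpace ℝ (Fin p)) :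
    inner ℝ (Matrix.toEuclideanCLM (n := Fin p) (𝕜 := ℝ) C u) v =
      inner ℝ u (Matrix.toEuclideanCLM (n := Fin p) (𝕜 := ℝ) C v) := by
  obtain ⟨G', hG, hG'⟩ := h
  have h1 : ∀ᶠ β in 𝓝 β₀, HasFDerivAt G (innerSL ℝ (G' β)) β := by
    filter_upwards [hG] with β hβ using hβ.hasFDerivAt
  have h2 := ((innerSL ℝ (E := EuclideanSpace ℝ (Fin p))).hasFDerivAt (x := G' β₀)).comp β₀ hG'
  have h3 : inner ℝ (Matrix.toEuclideanCLM (n := Fin p) (𝕜 := ℝ) C u) v =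
      inner ℝ (Matrix.toEuclideanCLM (n := Fin p) (𝕜 := ℝ) C v) u :=
    second_derivative_symmetric_of_eventually (f' := fun β => innerSL ℝ (G' β)) h1 h2 u v
  rw [h3, real_inner_comm]

/-- The second-order Taylor expansion of `G` at a minimiser, with Peano remainder. -/
lemma HasHessianAt.taylor (h : HasHessianAt G C β₀) (hmin : IsMinOn G Set.univ β₀) {ε : ℝ}
    (hε : 0 < ε) :
    ∃ δ > 0, ∀ u : EuclideanSpace ℝ (Fin p), ‖u‖ < δ →
      |G (β₀ + u) - G β₀ -
        1 / 2 * inner ℝ u (Matrix.toEuclideanCLM (n := Fin p) (𝕜 := ℝ) C u)| ≤ ε * ‖u‖ ^ 2 := by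
  have hsym := h.inner_comm
  obtain ⟨G', hG, hG'⟩ := h
  set A := Matrix.toEuclideanCLM (n := Fin p) (𝕜 := ℝ) C
  have hzero : G' β₀ = 0 := by
    have h1 := hG.self_of_nhds.hasFDerivAt
    have h2 := (hmin.isLocalMin Filter.univ_mem).hasFDerivAt_eq_zero h1
    simpa using h2
  have hsmall := (hasFDerivAt_iff_isLittleO.1 hG').def hε
  obtain ⟨δ, hδ, hball⟩ := Metric.eventually_nhds_iff.1 (hG.and hsmall)
  refine ⟨δ, hδ, fun u hu => ?_⟩
  -- The gradient of G minus the quadratic form has norm at most ε‖u‖ on the ball of radius ‖u‖, so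
  -- the mean value inequality gives the remainder.
  set φ : EuclideanSpace ℝ (Fin p) → ℝ := fun v => G (β₀ + v) - 1 / 2 * inner ℝ v (A v) with hφ
  have hderiv : ∀ v ∈ Metric.closedBall (0 : EuclideanSpace ℝ (Fin p)) ‖u‖,
      HasFDerivWithinAt φ (innerSL ℝ (G' (β₀ + v) - A v)) (Metric.closedBall 0 ‖u‖) v := by
    intro v hv
    have hv' : dist (β₀ + v) β₀ < δ := by
      rw [dist_eq_norm, add_sub_cancel_left]
      exact (mem_closedBall_zero_iff.1 hv).trans_lt hu
    have h1 : HasFDerivAt G (innerSL ℝ (G' (β₀ + v))) (β₀ + v) := (hball hv').1.hasFDerivAt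
    have h2 : HasFDerivAt (fun v => G (β₀ + v)) (innerSL ℝ (G' (β₀ + v))) v :=
      (hasFDerivAt_comp_add_left β₀).2 h1
    have h3 := (((hasFDerivAt_id v).inner ℝ (A.hasFDerivAt (x := v))).const_mul (1 / 2 : ℝ))
    refine ((h2.sub h3).congr_fderiv ?_).hasFDerivWithinAt
    ext y
    simp only [sub_apply, smul_apply, innerSL_apply_apply,
      ContinuousLinearMap.comp_apply, ContinuousLinearMap.prod_apply, id, fderivInnerCLM_apply,
      ContinuousLinearMap.coe_id', inner_sub_left, smul_eq_mul]
    rw [← hsym v y, real_inner_comm (A v) y]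
    ring
  have hbound : ∀ v ∈ Metric.closedBall (0 : EuclideanSpace ℝ (Fin p)) ‖u‖,
      ‖innerSL ℝ (G' (β₀ + v) - A v)‖ ≤ ε * ‖u‖ := by
    intro v hv
    have hvu := mem_closedBall_zero_iff.1 hv
    have hv' : dist (β₀ + v) β₀ < δ := by
      rw [dist_eq_norm, add_sub_cancel_left]
      exact hvu.trans_lt hu
    have h1 := (hball hv').2
    rw [hzero, sub_zero, add_sub_cancel_left] at h1
    rw [innerSL_apply_norm]
    exact h1.trans (mul_le_mul_of_nonneg_left hvu hε.le)
  have := (convex_closedBall (0 : EuclideanSpace ℝ (Fin p)) ‖u‖).norm_image_sub_le_of_norm_hasFDerivWithin_le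
    hderiv hbound (Metric.mem_closedBall_self (norm_nonneg u)) (mem_closedBall_zero_iff.2 le_rfl)
  simp only [hφ, add_zero, map_zero, inner_zero_left, mul_zero, sub_zero, Real.norm_eq_abs] at this
  calc _ = |G (β₀ + u) - 1 / 2 * inner ℝ u (A u) - G β₀| := by congr 1; ring
    _ ≤ ε * ‖u‖ * ‖u‖ := this
    _ = ε * ‖u‖ ^ 2 := by ring

lemma HasHessianAt.inner_nonneg (h : HasHessianAt G C β₀) (hmin : IsMinOn G Set.univ β₀)
    (u : EuclideanSpace ℝ (Fin p)) :
    0 ≤ inner ℝ u (Matrix.toEuclideanCLM (n := Fin p) (𝕜 := ℝ) C u) := by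
  set A := Matrix.toEuclideanCLM (n := Fin p) (𝕜 := ℝ) C
  by_contra hneg
  rw [not_le] at hneg
  have hu : u ≠ 0 := by
    rintro rfl
    simp at hneg
  have hu' : 0 < ‖u‖ := norm_pos_iff.2 hu
  -- This ε makes the Taylor error half of the assumed negative quadratic term, so G would drop
  -- below its minimum.
  obtain ⟨δ, hδ, hT⟩ := h.taylor hmin (ε := -(inner ℝ u (A u)) / (4 * ‖u‖ ^ 2)) (by
    have := neg_pos.2 hneg
    positivity)
  set t := δ / (2 * ‖u‖) with ht
  have ht0 : 0 < t := by positivity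
  have htn : ‖t • u‖ = δ / 2 := by
    rw [norm_smul, Real.norm_of_nonneg ht0.le, ht]
    field_simp
  have h1 := hT (t • u) (by rw [htn]; linarith)
  have h2 : G β₀ ≤ G (β₀ + t • u) := hmin (Set.mem_univ _)
  have h3 := (abs_le.1 h1).2
  have h4 : ‖t • u‖ ^ 2 = t ^ 2 * ‖u‖ ^ 2 := by
    rw [norm_smul, Real.norm_of_nonneg ht0.le, mul_pow]
  have h5 : -(inner ℝ u (A u)) / (4 * ‖u‖ ^ 2) * (t ^ 2 * ‖u‖ ^ 2) =
      -(inner ℝ u (A u)) * t ^ 2 / 4 := by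
    field_simp
  rw [h4, h5, map_smul, real_inner_smul_left, real_inner_smul_right] at h3
  nlinarith [mul_neg_of_neg_of_pos hneg (pow_pos ht0 2)]

/-- A non-singular Hessian at a minimiser is coercive. -/
lemma HasHessianAt.exists_coercive (h : HasHessianAt G C β₀) (hmin : IsMinOn G Set.univ β₀)
    (hC : IsUnit C.det) :
    ∃ c > 0, ∀ u : EuclideanSpace ℝ (Fin p),
      c * ‖u‖ ^ 2 ≤ inner ℝ u (Matrix.toEuclideanCLM (n := Fin p) (𝕜 := ℝ) C u) := by
  have hsym := h.inner_comm
  have hnn := h.inner_nonneg hmin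
  set A := Matrix.toEuclideanCLM (n := Fin p) (𝕜 := ℝ) C with hAdef
  have hpos : ∀ u : EuclideanSpace ℝ (Fin p), u ≠ 0 → 0 < inner ℝ u (A u) := by
    intro u hu
    refine lt_of_le_of_ne (hnn u) fun h0 => hu ?_
    -- A nonnegative symmetric form vanishing at u has u in its kernel: otherwise moving from u
    -- along −A u makes the form negative.
    have hAu : A u = 0 := by
      by_contra hne
      have hn : 0 < inner ℝ (A u) (A u) := real_inner_self_pos.2 hne
      set a := inner ℝ (A u) (A u) with ha
      set b := inner ℝ (A u) (A (A u)) with hb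
      have hb0 : 0 ≤ b := hnn (A u)
      have hexp : ∀ t : ℝ, 0 ≤ -2 * t * a + t ^ 2 * b := by
        intro t
        have h1 := hnn (u - t • A u)
        have h2 : inner ℝ u (A (A u)) = a := by rw [← hsym]
        simp only [map_sub, map_smul, inner_sub_left, inner_sub_right, real_inner_smul_left,
          real_inner_smul_right, ← h0, h2, ← ha, ← hb] at h1
        linarith
      have h3 := hexp (a / (b + 1))
      have h4 : -2 * (a / (b + 1)) * a + (a / (b + 1)) ^ 2 * b =
          -(a ^ 2 * (b + 2)) / (b + 1) ^ 2 := by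
        field_simp
        ring
      rw [h4] at h3
      have : -(a ^ 2 * (b + 2)) / (b + 1) ^ 2 < 0 := by
        apply div_neg_of_neg_of_pos
        · have : 0 < a ^ 2 * (b + 2) := by positivity
          linarith
        · positivity
      linarith
    have h1 : C.mulVec u.ofLp = 0 := by
      rw [← Matrix.ofLp_toEuclideanCLM, ← hAdef, hAu]
      rfl
    have h2 := Matrix.eq_zero_of_mulVec_eq_zero hC.ne_zero h1
    ext i
    exact congrFun h2 i
  -- The unit sphere is empty exactly when p = 0.
  rcases (Metric.sphere (0 : EuclideanSpace ℝ (Fin p)) 1).eq_empty_or_nonempty with he | he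
  · refine ⟨1, one_pos, fun u => ?_⟩
    have hu : u = 0 := by
      by_contra hne
      have : ‖u‖⁻¹ • u ∈ Metric.sphere (0 : EuclideanSpace ℝ (Fin p)) 1 := by
        rw [mem_sphere_zero_iff_norm, norm_smul, norm_inv, norm_norm,
          inv_mul_cancel₀ (norm_ne_zero_iff.2 hne)]
      simp [he] at this
    simp [hu]
  · have hcont : Continuous fun u : EuclideanSpace ℝ (Fin p) => inner ℝ u (A u) := by fun_prop
    obtain ⟨z, hz, hzmin⟩ := (isCompact_sphere (0 : EuclideanSpace ℝ (Fin p)) 1).exists_isMinOn he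
      hcont.continuousOn
    have hz0 : z ≠ 0 := by
      rintro rfl
      simp at hz
    refine ⟨inner ℝ z (A z), hpos z hz0, fun u => ?_⟩
    by_cases hu : u = 0
    · simp [hu]
    · have hun := norm_ne_zero_iff.2 hu
      have h1 : inner ℝ z (A z) ≤ inner ℝ (‖u‖⁻¹ • u) (A (‖u‖⁻¹ • u)) := by
        refine hzmin ?_
        rw [mem_sphere_zero_iff_norm, norm_smul, norm_inv, norm_norm, inv_mul_cancel₀ hun]
      rw [map_smul, real_inner_smul_left, real_inner_smul_right] at h1
      have h2 := mul_le_mul_of_nonneg_right h1 (sq_nonneg ‖u‖)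
      refine h2.trans_eq ?_
      field_simp

end Hessian

/-! ### Gaussian limits -/

section SecondMoment

variable {p : ℕ} {𝒵 : Type*} [MeasurableSpace 𝒵] {P : Measure 𝒵}
  {Δ : 𝒵 → EuclideanSpace ℝ (Fin p)}

lemma MeasureTheory.MemLp.apply_euclideanSpace (hΔ : MemLp Δ 2 P) (i : Fin p) :
    MemLp (fun z => Δ z i) 2 P :=
  hΔ.continuousLinearMap_comp (EuclideanSpace.proj (𝕜 := ℝ) i)

lemma dotProduct_secondMomentMatrix_mulVec (hΔ : MemLp Δ 2 P)
    (v : EuclideanSpace ℝ (Fin p)) :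
    v.ofLp ⬝ᵥ (secondMomentMatrix P Δ).mulVec v.ofLp = ∫ z, inner ℝ v (Δ z) ^ 2 ∂P := by
  have hint : ∀ i j, Integrable (fun z => v i * v j * (Δ z i * Δ z j)) P := fun i j =>
    ((hΔ.apply_euclideanSpace i).integrable_mul (hΔ.apply_euclideanSpace j)).const_mul _
  have hexp : ∀ z, inner ℝ v (Δ z) ^ 2 = ∑ i, ∑ j, v i * v j * (Δ z i * Δ z j) := by
    intro z
    rw [sq, PiLp.inner_apply, Finset.sum_mul_sum]
    refine Finset.sum_congr rfl fun i _ => Finset.sum_congr rfl fun j _ => ?_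
    simp only [RCLike.inner_apply, conj_trivial]
    ring
  simp only [hexp]
  rw [integral_finsetSum _ fun i _ => integrable_finsetSum _ fun j _ => hint i j]
  simp only [dotProduct, Matrix.mulVec, secondMomentMatrix, Matrix.of_apply, Finset.mul_sum]
  refine Finset.sum_congr rfl fun i _ => ?_
  rw [integral_finsetSum _ fun j _ => hint i j]
  refine Finset.sum_congr rfl fun j _ => ?_
  rw [integral_const_mul]
  ring

lemma posSemidef_secondMomentMatrix (hΔ : MemLp Δ 2 P) : (secondMomentMatrix P Δ).PosSemidef := by
  refine Matrix.PosSemidef.of_dotProduct_mulVec_nonneg ?_ fun x => ?_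
  · ext i j
    simp only [secondMomentMatrix, Matrix.conjTranspose_apply, Matrix.of_apply, star_trivial,
      mul_comm]
  · have h := dotProduct_secondMomentMatrix_mulVec hΔ (WithLp.toLp 2 x)
    simp only [star_trivial]
    rw [h]
    exact integral_nonneg fun z => sq_nonneg _

lemma secondMomentMatrix_neg (P : Measure 𝒵) (Δ : 𝒵 → EuclideanSpace ℝ (Fin p)) :
    secondMomentMatrix P (fun z => -Δ z) = secondMomentMatrix P Δ := by
  ext i j
  simp [secondMomentMatrix]

end SecondMoment

/-- A non-degenerate Gaussian measure charges no hyperplane. -/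
lemma multivariateGaussian_hyperplane {p : ℕ} {S : Matrix (Fin p) (Fin p) ℝ} (hS : S.PosDef)
    {v : EuclideanSpace ℝ (Fin p)} (hv : v ≠ 0) (b : ℝ) :
    multivariateGaussian 0 S {w | inner ℝ v w = b} = 0 := by
  set γ := multivariateGaussian 0 S
  have hmap : γ {w | inner ℝ v w = b} = γ.map (innerSL ℝ v) {b} := by
    rw [Measure.map_apply (by fun_prop) (measurableSet_singleton b)]
    rfl
  have hvar : Var[innerSL ℝ v; γ] = v.ofLp ⬝ᵥ S.mulVec v.ofLp := by
    rw [← covarianceBilin_multivariateGaussian (μ := 0) hS.posSemidef,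
      covarianceBilin_self IsGaussian.memLp_two_id]
    rfl
  have hpos : 0 < v.ofLp ⬝ᵥ S.mulVec v.ofLp := by
    have h := hS.dotProduct_mulVec_pos (x := v.ofLp) fun h => hv (by ext i; exact congrFun h i)
    simpa using h
  rw [hmap, IsGaussian.map_eq_gaussianReal, hvar]
  have := nullSingletonClass_gaussianReal (μ := ∫ x, innerSL ℝ v x ∂γ)
    (v := (v.ofLp ⬝ᵥ S.mulVec v.ofLp).toNNReal) (by simpa using hpos)
  exact measure_singleton b

/-- The central limit theorem in Euclidean space. -/
theorem tendstoInDistribution_inv_sqrt_smul_sum {p : ℕ} {Ω Ω' 𝒵 : Type*} [MeasurableSpace Ω]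
    [MeasurableSpace Ω'] [MeasurableSpace 𝒵] {μ : Measure Ω} [IsProbabilityMeasure μ]
    {μ' : Measure Ω'} [IsProbabilityMeasure μ'] {P : Measure 𝒵} {Z : ℕ → Ω → 𝒵}
    (hlaw : ∀ i, HasLaw (Z i) P μ) (hindep : iIndepFun Z μ)
    {Δ : 𝒵 → EuclideanSpace ℝ (Fin p)} (hΔ_meas : Measurable Δ) (hΔ_sq : MemLp Δ 2 P)
    (hΔ_mean : ∫ z, Δ z ∂P = 0) {W : Ω' → EuclideanSpace ℝ (Fin p)}
    (hW : HasLaw W (multivariateGaussian 0 (secondMomentMatrix P Δ)) μ') :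
    TendstoInDistribution (fun (n : ℕ) ω => (√(n : ℝ))⁻¹ • ∑ i ∈ Finset.range n, Δ (Z i ω))
      atTop W (fun _ => μ) μ' := by
  have hZ : ∀ i, AEMeasurable (Z i) μ := fun i => (hlaw i).aemeasurable
  have hΔZ : ∀ i, AEMeasurable (fun ω => Δ (Z i ω)) μ := fun i =>
    hΔ_meas.comp_aemeasurable (hZ i)
  have hP : IsProbabilityMeasure P := (hlaw 0).isProbabilityMeasure_iff.1 inferInstance
  have hS : ∀ n : ℕ, AEMeasurable
      (fun ω => (√(n : ℝ))⁻¹ • ∑ i ∈ Finset.range n, Δ (Z i ω)) μ := fun n =>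
    (measurable_const_smul (√(n : ℝ))⁻¹).comp_aemeasurable
      (Finset.aemeasurable_fun_sum (Finset.range n) fun i _ => hΔZ i)
  refine ⟨hS, hW.aemeasurable, ProbabilityMeasure.tendsto_iff_tendsto_charFun.2 fun t => ?_⟩
  simp only [ProbabilityMeasure.coe_mk]
  -- Cramér–Wold: the characteristic function at t is that of the scalar sums of Y at the argument
  -- 1.
  set Y : ℕ → Ω → ℝ := fun i ω => inner ℝ t (Δ (Z i ω)) with hY
  have hmeas : Measurable fun z => inner ℝ t (Δ z) := by fun_prop
  have hYident : ∀ i, IdentDistrib (Y i) (Y 0) μ μ := fun i =>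
    ((hlaw i).identDistrib (hlaw 0)).comp hmeas
  have hYindep : iIndepFun Y μ := hindep.comp (fun _ z => inner ℝ t (Δ z)) fun _ => hmeas
  have hmem : MemLp (fun z => inner ℝ t (Δ z)) 2 P :=
    hΔ_sq.continuousLinearMap_comp (innerSL ℝ t)
  have hY0 : MemLp (Y 0) 2 μ := by
    have h := hmem
    rw [← (hlaw 0).map_eq] at h
    exact h.comp_of_map (hZ 0)
  have hmean : μ[Y 0] = 0 := by
    have h1 : ∫ z, inner ℝ t (Δ z) ∂P = 0 := by
      rw [integral_inner (hΔ_sq.integrable one_le_two), hΔ_mean, inner_zero_right]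
    rw [← h1]
    exact (hlaw 0).integral_comp hmeas.aestronglyMeasurable
  have hvar : Var[Y 0; μ] = t.ofLp ⬝ᵥ (secondMomentMatrix P Δ).mulVec t.ofLp := by
    rw [dotProduct_secondMomentMatrix_mulVec hΔ_sq,
      variance_of_integral_eq_zero hY0.aestronglyMeasurable.aemeasurable hmean]
    exact (hlaw 0).integral_comp (hmeas.pow_const 2).aestronglyMeasurable
  have hnn : 0 ≤ t.ofLp ⬝ᵥ (secondMomentMatrix P Δ).mulVec t.ofLp := hvar ▸ variance_nonneg _ _
  have hclt := tendstoInDistribution_inv_sqrt_mul_sum_sub (P := μ)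
    (Y := id) (P' := gaussianReal 0 Var[Y 0; μ].toNNReal) HasLaw.id hY0 hYindep hYident
  have hchar := ProbabilityMeasure.tendsto_iff_tendsto_charFun.1 hclt.tendsto 1
  simp only [ProbabilityMeasure.coe_mk, Measure.map_id] at hchar
  rw [charFun_gaussianReal, hvar] at hchar
  rw [hW.map_eq, charFun_multivariateGaussian (posSemidef_secondMomentMatrix hΔ_sq)]
  convert hchar using 2
  · rename_i n
    rw [charFun_apply, charFun_apply, integral_map (hS n) (by fun_prop),
      integral_map (hclt.forall_aemeasurable n) (by fun_prop)]
    refine integral_congr_ae (Eventually.of_forall fun ω => ?_)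
    have hsum : inner ℝ ((√(n : ℝ))⁻¹ • ∑ i ∈ Finset.range n, Δ (Z i ω)) t =
        (√(n : ℝ))⁻¹ * ∑ i ∈ Finset.range n, Y i ω := by
      rw [real_inner_comm, real_inner_smul_right, inner_sum]
    simp only [hmean, mul_zero, sub_zero, hsum, one_mul, RCLike.inner_apply, conj_trivial]
  · simp [Real.coe_toNNReal _ hnn]

/-! ### Transfer of stable events -/

/-- If, for almost every limit point `w` in `D`, the event `A n` holds as soon as the driving
sequence is near `w` and the error is small, then `A n` has asymptotically at least the limiting
probability of `D`. -/
theorem measure_le_liminf_of_tendstoInDistribution {E Ω Ω' : Type*} [PseudoMetricSpace E]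
    [MeasurableSpace E] [BorelSpace E] [MeasurableSpace Ω] [MeasurableSpace Ω']
    {μ : Measure Ω} [IsProbabilityMeasure μ] {μ' : Measure Ω'} [IsProbabilityMeasure μ']
    {X : ℕ → Ω → E} {W : Ω' → E} (h : TendstoInDistribution X atTop W (fun _ => μ) μ')
    {D : Set E} {A : ℕ → Set Ω} {H : ℕ → ℕ → Set Ω} (hH_anti : ∀ n, Antitone (H n))
    (hH : ∀ k, Tendsto (fun n => μ (H n k)ᶜ) atTop (𝓝 0))
    (hD : ∀ᵐ w ∂(μ'.map W), w ∈ D → ∃ k : ℕ, ∀ n, k ≤ n → ∀ ω ∈ H n k,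
      dist (X n ω) w < 1 / ((k : ℝ) + 1) → ω ∈ A n) :
    μ'.map W D ≤ liminf (fun n => μ (A n)) atTop := by
  -- S k collects the limit points for which tolerance k suffices. Balls around them form an open
  -- set, so neither S k, D nor A n has to be measurable.
  set S : ℕ → Set E := fun k => {w | ∀ n, k ≤ n → ∀ ω ∈ H n k,
      dist (X n ω) w < 1 / ((k : ℝ) + 1) → ω ∈ A n} with hS
  set O : ℕ → Set E := fun k => ⋃ w ∈ S k, Metric.ball w (1 / ((k : ℝ) + 1)) with hO
  have hOopen : ∀ k, IsOpen (O k) := fun k => isOpen_biUnion fun w _ => Metric.isOpen_ball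
  have hsub : ∀ k n, k ≤ n → X n ⁻¹' (Set.accumulate O k) ⊆ A n ∪ (H n k)ᶜ := by
    intro k n hkn ω hω
    by_cases hωH : ω ∈ H n k
    · left
      obtain ⟨j, hj, hωj⟩ := Set.mem_accumulate.1 hω
      obtain ⟨w, hw, hdist⟩ := Set.mem_iUnion₂.1 hωj
      exact hw n (hj.trans hkn) ω (hH_anti n hj hωH) hdist
    · exact Or.inr hωH
  have hbound : ∀ k, μ'.map W (Set.accumulate O k) ≤ liminf (fun n => μ (A n)) atTop := by
    intro k
    have hacc : IsOpen (Set.accumulate O k) := isOpen_biUnion fun j _ => hOopen j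
    have h1 := ProbabilityMeasure.le_liminf_measure_open_of_tendsto h.tendsto hacc
    refine (h1.trans ?_ : _ ≤ _)
    rw [← ENNReal.liminf_add_of_right_tendsto_zero (hH k) fun n => μ (A n)]
    refine liminf_le_liminf ?_
    filter_upwards [eventually_ge_atTop k] with n hn
    simp only [ProbabilityMeasure.coe_mk, Pi.add_apply]
    rw [Measure.map_apply_of_aemeasurable (h.forall_aemeasurable n) hacc.measurableSet]
    exact (measure_mono (hsub k n hn)).trans (measure_union_le (μ := μ) _ _)
  have hlim := tendsto_measure_iUnion_accumulate (μ := μ'.map W) (f := O)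
  have hcover : μ'.map W D ≤ μ'.map W (⋃ k, O k) := by
    refine measure_mono_ae ?_
    filter_upwards [hD] with w hw hwD
    obtain ⟨k, hk⟩ := hw hwD
    exact Set.mem_iUnion.2 ⟨k, Set.mem_iUnion₂.2 ⟨w, hk, Metric.mem_ball_self (by positivity)⟩⟩
  exact hcover.trans (le_of_tendsto' hlim hbound)

/-! ### Local minimisation problems -/

/-- Minimisers of convex, asymptotically quadratic functions with a SLOPE penalty around the
point `T k • β₀` converge; eventually the penalty acts through its directional derivative. -/
lemma tendsto_localMinimizers {p : ℕ}
    {A : EuclideanSpace ℝ (Fin p) →L[ℝ] EuclideanSpace ℝ (Fin p)}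
    {β₀ w u : EuclideanSpace ℝ (Fin p)} {lam : Fin p → ℝ} (hlam_anti : Antitone lam)
    (hlam_nonneg : ∀ i, 0 ≤ lam i)
    (hu : ∀ y, y ≠ u → 1 / 2 * inner ℝ u (A u) - inner ℝ u w + slopeDirDeriv lam β₀ u <
      1 / 2 * inner ℝ y (A y) - inner ℝ y w + slopeDirDeriv lam β₀ y)
    {T : ℕ → ℝ} (hT : Tendsto T atTop atTop) {μ : ℕ → Fin p → ℝ}
    (hμ_anti : ∀ k, Antitone (μ k)) (hμ_nonneg : ∀ k i, 0 ≤ μ k i)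
    (hμ : Tendsto μ atTop (𝓝 lam)) {f : ℕ → EuclideanSpace ℝ (Fin p) → ℝ}
    (hf : ∀ k, ConvexOn ℝ Set.univ (f k))
    (hlim : ∀ R ε : ℝ, 0 < ε → ∀ᶠ k in atTop, ∀ y, ‖y‖ ≤ R →
      |f k y - (1 / 2 * inner ℝ y (A y) - inner ℝ y w)| ≤ ε)
    {uk : ℕ → EuclideanSpace ℝ (Fin p)}
    (hmin : ∀ k, IsMinOn (fun y => f k y + slopeNorm (μ k) (T k • β₀ + y)) Set.univ (uk k)) :
    Tendsto uk atTop (𝓝 u) ∧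
      (∀ᶠ k in atTop, IsMinOn (fun y => f k y + slopeDirDeriv (μ k) β₀ y) Set.univ (uk k)) ∧
      ∀ᶠ k in atTop, limitingPattern β₀ (uk k) = slopePattern (T k • β₀ + uk k) := by
  have hexact : ∀ R : ℝ, ∀ᶠ k in atTop, ∀ y : EuclideanSpace ℝ (Fin p), ‖y‖ ≤ R →
      limitingPattern β₀ y = slopePattern (T k • β₀ + y) ∧
      slopeNorm (μ k) (T k • β₀ + y) =
        slopeNorm (μ k) (T k • β₀) + slopeDirDeriv (μ k) β₀ y := by
    intro R
    obtain ⟨T₀, -, h⟩ := exists_forall_slopeNorm_eq_add_slopeDirDeriv β₀ R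
    filter_upwards [hT.eventually_ge_atTop T₀] with k hk y hy
    exact ⟨(h _ hk y hy).1, ((h _ hk y hy).2 _ (hμ_anti k) (hμ_nonneg k)).1⟩
  have hconvN : ∀ k, ConvexOn ℝ Set.univ (fun y => slopeNorm (μ k) (T k • β₀ + y)) := fun k =>
    (convexOn_slopeNorm (hμ_anti k) (hμ_nonneg k)).translate_right _
  have htend : Tendsto uk atTop (𝓝 u) := by
    have hcont := continuous_slopeDirDeriv hlam_anti hlam_nonneg β₀
    refine tendsto_of_isMinOn_of_convexOn
      (Q := fun y => 1 / 2 * inner ℝ y (A y) - inner ℝ y w + slopeDirDeriv lam β₀ y)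
      (F := fun k y => f k y + slopeNorm (μ k) (T k • β₀ + y) + -slopeNorm (μ k) (T k • β₀))
      (by fun_prop) hu (fun k => ((hf k).add (hconvN k)).add_const _) ?_ ?_
    · intro R ε hε
      have hsum : Tendsto (fun k => (∑ i, |μ k i - lam i|) * |R|) atTop (𝓝 0) := by
        have h1 : Tendsto (fun k => ∑ i, |μ k i - lam i|) atTop (𝓝 (∑ _i : Fin p, (0 : ℝ))) :=
          tendsto_finsetSum _ fun i _ => by
            have := ((tendsto_pi_nhds.1 hμ i).sub_const (lam i)).abs
            simpa using this
        simpa using h1.mul_const |R|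
      filter_upwards [hexact R, hlim R (ε / 2) (by positivity),
        hsum.eventually_le_const (half_pos hε)] with k hk1 hk2 hk3 y hy
      rw [(hk1 y hy).2]
      have h1 := abs_slopeDirDeriv_sub_le (hμ_anti k) (hμ_nonneg k) hlam_anti hlam_nonneg β₀ y
      have h2 : (∑ i, |μ k i - lam i|) * ‖y‖ ≤ ε / 2 :=
        (mul_le_mul_of_nonneg_left (hy.trans (le_abs_self R))
          (Finset.sum_nonneg fun i _ => abs_nonneg _)).trans hk3
      have h3 := hk2 y hy
      rw [abs_le] at h1 h3 ⊢
      constructor <;> linarith [h1.1, h1.2, h3.1, h3.2]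
    · intro k y hy
      have : f k (uk k) + slopeNorm (μ k) (T k • β₀ + uk k) ≤
          f k y + slopeNorm (μ k) (T k • β₀ + y) := hmin k hy
      simp only [Set.mem_ofPred_eq]
      linarith
  have hbdd : ∀ᶠ k in atTop, ‖uk k‖ < ‖u‖ + 1 :=
    htend.norm.eventually_lt_const (by linarith)
  refine ⟨htend, ?_, ?_⟩
  · filter_upwards [hexact (‖u‖ + 1), hbdd] with k hk hkb
    -- The penalty is exactly its directional derivative only on a ball, which yields a local
    -- minimum; convexity makes it global.
    have hloc : IsLocalMin (fun y => f k y + slopeDirDeriv (μ k) β₀ y) (uk k) := by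
      have hnear : ∀ᶠ y in 𝓝 (uk k), ‖y‖ < ‖u‖ + 1 :=
        continuous_norm.continuousAt.eventually_lt_const hkb
      filter_upwards [hnear] with y hy
      have h1 : f k (uk k) + slopeNorm (μ k) (T k • β₀ + uk k) ≤
          f k y + slopeNorm (μ k) (T k • β₀ + y) := hmin k (Set.mem_univ y)
      rw [(hk y hy.le).2, (hk _ hkb.le).2] at h1
      linarith
    have := IsMinOn.of_isLocalMin_of_convex_univ hloc
      ((hf k).add (convexOn_slopeDirDeriv (hμ_anti k) (hμ_nonneg k) β₀))
    exact fun y _ => this y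
  · filter_upwards [hexact (‖u‖ + 1), hbdd] with k hk hkb
    exact (hk _ hkb.le).1

/-! ### The local asymptotic quadratic expansion -/

section Expansion

variable {p : ℕ} {Ω 𝒵 : Type*}

/-- The increment of the empirical loss in the local coordinate `u = √n (β - β₀)`. -/
noncomputable def localLoss (g : 𝒵 → EuclideanSpace ℝ (Fin p) → ℝ)
    (β₀ : EuclideanSpace ℝ (Fin p)) (n : ℕ) (Z : ℕ → 𝒵) (u : EuclideanSpace ℝ (Fin p)) : ℝ :=
  ∑ i ∈ Finset.range n, (g (Z i) (β₀ + (√(n : ℝ))⁻¹ • u) - g (Z i) β₀)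

/-- The normalised negative score. -/
noncomputable def normalizedScore (Δ : 𝒵 → EuclideanSpace ℝ (Fin p)) (n : ℕ) (Z : ℕ → 𝒵) :
    EuclideanSpace ℝ (Fin p) :=
  (√(n : ℝ))⁻¹ • ∑ i ∈ Finset.range n, -Δ (Z i)

variable {g : 𝒵 → EuclideanSpace ℝ (Fin p) → ℝ}
  {Δ : 𝒵 → EuclideanSpace ℝ (Fin p)} {β₀ : EuclideanSpace ℝ (Fin p)}

lemma convexOn_localLoss (hg : ∀ z, ConvexOn ℝ Set.univ (g z)) (β₀ : EuclideanSpace ℝ (Fin p))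
    (n : ℕ) (Z : ℕ → 𝒵) : ConvexOn ℝ Set.univ (localLoss g β₀ n Z) := by
  refine ⟨convex_univ, fun x _ y _ a b ha hb hab => ?_⟩
  simp only [localLoss, Finset.smul_sum, ← Finset.sum_add_distrib]
  refine Finset.sum_le_sum fun i _ => ?_
  have h := (hg (Z i)).2 (Set.mem_univ (β₀ + (√(n : ℝ))⁻¹ • x))
    (Set.mem_univ (β₀ + (√(n : ℝ))⁻¹ • y)) ha hb hab
  have hcomb : a • (β₀ + (√(n : ℝ))⁻¹ • x) + b • (β₀ + (√(n : ℝ))⁻¹ • y) =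
      β₀ + (√(n : ℝ))⁻¹ • (a • x + b • y) := by
    have : β₀ = a • β₀ + b • β₀ := by rw [← add_smul, hab, one_smul]
    nth_rw 3 [this]
    simp only [smul_add, smul_comm a, smul_comm b]
    abel
  rw [hcomb] at h
  simp only [smul_eq_mul] at h ⊢
  have : g (Z i) β₀ = a * g (Z i) β₀ + b * g (Z i) β₀ := by rw [← add_mul, hab, one_mul]
  linarith

/-- Summing the definition of the rest term splits the loss into mean increment, linear score and
empirical-process remainder; centring is free because Δ has mean zero. -/
lemma localLoss_eq [MeasurableSpace 𝒵] {P : Measure 𝒵}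
    (hg_int : ∀ β, Integrable (fun z => g z β) P)
    (hΔ : Integrable Δ P) (hΔ_mean : ∫ z, Δ z ∂P = 0) (Z : ℕ → Ω → 𝒵) {n : ℕ} (hn : 0 < n)
    (ω : Ω) (u : EuclideanSpace ℝ (Fin p)) :
    localLoss g β₀ n (fun i => Z i ω) u =
      n * (∫ z, g z (β₀ + (√(n : ℝ))⁻¹ • u) ∂P - ∫ z, g z β₀ ∂P) -
        inner ℝ u (normalizedScore Δ n fun i => Z i ω) +
        ‖u‖ * centredEmpiricalSum P Z n
          (expansionRest g Δ β₀ (β₀ + (√(n : ℝ))⁻¹ • u)) ω := by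
  have hs : 0 < √(n : ℝ) := Real.sqrt_pos.2 (by exact_mod_cast hn)
  by_cases hu : u = 0
  · simp [hu, localLoss]
  set d := (√(n : ℝ))⁻¹ * ‖u‖ with hd
  have hd0 : d ≠ 0 := mul_ne_zero (inv_ne_zero hs.ne') (norm_ne_zero_iff.2 hu)
  set v := (√(n : ℝ))⁻¹ • u with hv
  have hvn : ‖v‖ = d := by rw [hv, norm_smul, Real.norm_of_nonneg (inv_nonneg.2 hs.le)]
  have hint : Integrable (fun z => inner ℝ v (Δ z)) P := hΔ.const_inner v
  have hmean : ∫ z, expansionRest g Δ β₀ (β₀ + v) z ∂P =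
      (∫ z, g z (β₀ + v) ∂P - ∫ z, g z β₀ ∂P) / d := by
    simp only [expansionRest, add_sub_cancel_left, hvn]
    rw [integral_div, integral_sub (f := fun z => g z (β₀ + v) - g z β₀) ((hg_int _).sub (hg_int _)) hint,
      integral_sub (hg_int _) (hg_int _), integral_inner hΔ, hΔ_mean, inner_zero_right, sub_zero]
  rw [centredEmpiricalSum, hmean, ← mul_assoc, mul_comm ‖u‖, ← hd, Finset.mul_sum]
  have hterm : ∀ i ∈ Finset.range n, d * (expansionRest g Δ β₀ (β₀ + v) (Z i ω) -
      (∫ z, g z (β₀ + v) ∂P - ∫ z, g z β₀ ∂P) / d) =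
      (g (Z i ω) (β₀ + v) - g (Z i ω) β₀) - inner ℝ v (Δ (Z i ω)) -
        (∫ z, g z (β₀ + v) ∂P - ∫ z, g z β₀ ∂P) := by
    intro i _
    simp only [expansionRest, add_sub_cancel_left, hvn]
    field_simp
  have hscore : inner ℝ u (normalizedScore Δ n fun i => Z i ω) =
      -∑ i ∈ Finset.range n, inner ℝ v (Δ (Z i ω)) := by
    rw [normalizedScore, real_inner_smul_right, ← real_inner_smul_left, ← hv, inner_sum,
      ← Finset.sum_neg_distrib]
    simp only [inner_neg_right]
  rw [Finset.sum_congr rfl hterm, Finset.sum_sub_distrib, Finset.sum_sub_distrib, hscore,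
    Finset.sum_const, Finset.card_range, nsmul_eq_mul, localLoss]
  ring

/-- Under stochastic differentiability the local loss is, uniformly on bounded sets and with
probability tending to one, a quadratic function with random linear term. -/
theorem tendsto_measure_localLoss_sub_quadratic [MeasurableSpace Ω] [MeasurableSpace 𝒵] {μ : Measure Ω}
    {P : Measure 𝒵}
    {Z : ℕ → Ω → 𝒵} (hg_int : ∀ β, Integrable (fun z => g z β) P) (hΔ : Integrable Δ P)
    (hΔ_mean : ∫ z, Δ z ∂P = 0) {C : Matrix (Fin p) (Fin p) ℝ}
    (hmin : IsMinOn (fun β => ∫ z, g z β ∂P) Set.univ β₀)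
    (hHess : HasHessianAt (fun β => ∫ z, g z β ∂P) C β₀)
    (hsd : StochasticallyDifferentiableAt μ P Z g Δ β₀) (K : ℕ) :
    Tendsto (fun n => μ {ω | ¬ ∀ u : EuclideanSpace ℝ (Fin p), ‖u‖ ≤ K →
      |localLoss g β₀ n (fun i => Z i ω) u -
        (1 / 2 * inner ℝ u (Matrix.toEuclideanCLM (n := Fin p) (𝕜 := ℝ) C u) -
          inner ℝ u (normalizedScore Δ n fun i => Z i ω))| ≤ 1 / ((K : ℝ) + 1)})
      atTop (𝓝 0) := by
  set A := Matrix.toEuclideanCLM (n := Fin p) (𝕜 := ℝ) C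
  -- The Taylor and stochastic errors add up to ε(‖u‖² + ‖u‖(1 + ‖u‖)) ≤ 2ε(K + 1)², which is then
  -- 1/(K + 1).
  set ε : ℝ := 1 / (2 * ((K : ℝ) + 1) ^ 3) with hε
  have hK : (0 : ℝ) ≤ K := K.cast_nonneg
  have hε0 : 0 < ε := by positivity
  obtain ⟨δ, hδ, hT⟩ := hHess.taylor hmin hε0
  -- The maximum with 1 and the radius K + 1 keep U n a neighbourhood even when n = 0 or K = 0.
  have hrad : Tendsto (fun n : ℕ => ((K : ℝ) + 1) / √(max (n : ℝ) 1)) atTop (𝓝 0) := by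
    refine Tendsto.div_atTop tendsto_const_nhds ?_
    exact Real.tendsto_sqrt_atTop.comp
      (tendsto_atTop_mono (fun n => le_max_left _ _) tendsto_natCast_atTop_atTop)
  set U : ℕ → Set (EuclideanSpace ℝ (Fin p)) := fun n =>
    Metric.closedBall β₀ (((K : ℝ) + 1) / √(max (n : ℝ) 1)) with hU
  have hUmem : ∀ n, U n ∈ 𝓝 β₀ := fun n => Metric.closedBall_mem_nhds _ (by positivity)
  have hUsub : ∀ O ∈ 𝓝 β₀, ∀ᶠ n in atTop, U n ⊆ O := by
    intro O hO
    obtain ⟨r, hr, hrO⟩ := Metric.nhds_basis_closedBall.mem_iff.1 hO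
    filter_upwards [hrad.eventually_le_const hr] with n hn
    exact (Metric.closedBall_subset_closedBall hn).trans hrO
  refine tendsto_of_tendsto_of_tendsto_of_le_of_le' tendsto_const_nhds
    (hsd U hUmem hUsub ε hε0) (Eventually.of_forall fun _ => zero_le) ?_
  filter_upwards [hrad.eventually_lt_const hδ, eventually_ge_atTop 1] with n hnδ hn
  refine measure_mono fun ω hω => ?_
  by_contra hnot
  simp only [Set.mem_ofPred_eq, not_le] at hnot
  refine hω fun u hu => ?_
  have hn1 : max (n : ℝ) 1 = n := max_eq_left (by exact_mod_cast hn)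
  rw [hn1] at hnδ
  have hn0 : (0 : ℝ) < n := by exact_mod_cast hn
  have hs : 0 < √(n : ℝ) := Real.sqrt_pos.2 hn0
  set v := (√(n : ℝ))⁻¹ • u with hv
  have hvn : ‖v‖ = ‖u‖ / √(n : ℝ) := by
    rw [hv, norm_smul, Real.norm_of_nonneg (inv_nonneg.2 hs.le), inv_mul_eq_div]
  have hvle : ‖v‖ ≤ ((K : ℝ) + 1) / √(n : ℝ) := by
    rw [hvn]
    gcongr
    linarith
  have hTv := hT v (hvle.trans_lt hnδ)
  have hmem : β₀ + v ∈ U n := by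
    rw [hU, mem_closedBall_iff_norm, add_sub_cancel_left, hn1]
    exact hvle
  have hsup := (le_iSup₂ (f := fun β (_ : β ∈ U n) => ‖centredEmpiricalSum P Z n
    (expansionRest g Δ β₀ β) ω / (1 + √(n : ℝ) * ‖β - β₀‖)‖ₑ) (β₀ + v) hmem).trans_lt hnot
  rw [add_sub_cancel_left, hvn, mul_div_cancel₀ _ hs.ne', ← ofReal_norm,
    ENNReal.ofReal_lt_ofReal_iff hε0, norm_div, Real.norm_of_nonneg (by positivity :
      0 ≤ 1 + ‖u‖), div_lt_iff₀ (by positivity), Real.norm_eq_abs] at hsup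
  rw [localLoss_eq hg_int hΔ hΔ_mean Z hn ω u]
  set ν := centredEmpiricalSum P Z n (expansionRest g Δ β₀ (β₀ + v)) ω
  have hquad : inner ℝ u (A u) = n * inner ℝ v (A v) := by
    rw [hv, map_smul, real_inner_smul_left, real_inner_smul_right, ← mul_assoc, ← mul_assoc,
      mul_assoc (n : ℝ), ← mul_inv, Real.mul_self_sqrt hn0.le, mul_inv_cancel₀ hn0.ne', one_mul]
  have hvsq : n * ‖v‖ ^ 2 = ‖u‖ ^ 2 := by
    rw [hvn, div_pow, Real.sq_sqrt hn0.le]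
    field_simp
  have h1 : |n * (∫ z, g z (β₀ + v) ∂P - ∫ z, g z β₀ ∂P - 1 / 2 * inner ℝ v (A v))| ≤
      ε * ‖u‖ ^ 2 := by
    rw [abs_mul, abs_of_pos hn0, ← hvsq]
    calc _ ≤ (n : ℝ) * (ε * ‖v‖ ^ 2) := mul_le_mul_of_nonneg_left hTv hn0.le
      _ = _ := by ring
  have h2 : |‖u‖ * ν| ≤ ‖u‖ * (ε * (1 + ‖u‖)) := by
    rw [abs_mul, abs_norm]
    exact mul_le_mul_of_nonneg_left hsup.le (norm_nonneg u)
  have h3 : ε * ‖u‖ ^ 2 + ‖u‖ * (ε * (1 + ‖u‖)) ≤ 1 / ((K : ℝ) + 1) := by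
    have h4 : ‖u‖ ^ 2 + ‖u‖ * (1 + ‖u‖) ≤ 2 * ((K : ℝ) + 1) ^ 2 := by
      nlinarith [norm_nonneg u]
    calc _ = ε * (‖u‖ ^ 2 + ‖u‖ * (1 + ‖u‖)) := by ring
      _ ≤ ε * (2 * ((K : ℝ) + 1) ^ 2) := mul_le_mul_of_nonneg_left h4 hε0.le
      _ = 1 / ((K : ℝ) + 1) := by
        rw [hε]
        field_simp
  have hdecomp : n * (∫ z, g z (β₀ + v) ∂P - ∫ z, g z β₀ ∂P) -
        inner ℝ u (normalizedScore Δ n fun i => Z i ω) + ‖u‖ * ν -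
      (1 / 2 * inner ℝ u (A u) - inner ℝ u (normalizedScore Δ n fun i => Z i ω)) =
      n * (∫ z, g z (β₀ + v) ∂P - ∫ z, g z β₀ ∂P - 1 / 2 * inner ℝ v (A v)) + ‖u‖ * ν := by
    rw [hquad]
    ring
  rw [hdecomp]
  exact (abs_add_le _ _).trans ((add_le_add h1 h2).trans h3)

/-- A minimiser of the penalised risk minimises the local objective. -/
lemma isMinOn_localLoss_add_slopeNorm {lam : Fin p → ℝ} {n : ℕ} (hn : 0 < n) {Z : ℕ → 𝒵}
    {β : EuclideanSpace ℝ (Fin p)} (h : IsMinOn (penalizedRisk g lam n Z) Set.univ β)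
    (β₀ : EuclideanSpace ℝ (Fin p)) :
    IsMinOn (fun u => localLoss g β₀ n Z u +
      slopeNorm ((√(n : ℝ))⁻¹ • lam) (√(n : ℝ) • β₀ + u)) Set.univ (√(n : ℝ) • (β - β₀)) := by
  have hn0 : (0 : ℝ) < n := by exact_mod_cast hn
  have hs : 0 < √(n : ℝ) := Real.sqrt_pos.2 hn0
  have key : ∀ u, localLoss g β₀ n Z u +
      slopeNorm ((√(n : ℝ))⁻¹ • lam) (√(n : ℝ) • β₀ + u) =
      n * penalizedRisk g lam n Z (β₀ + (√(n : ℝ))⁻¹ • u) -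
        ∑ i ∈ Finset.range n, g (Z i) β₀ := by
    intro u
    have h1 : √(n : ℝ) • β₀ + u = √(n : ℝ) • (β₀ + (√(n : ℝ))⁻¹ • u) := by
      rw [smul_add, smul_smul, mul_inv_cancel₀ hs.ne', one_smul]
    rw [h1, slopeNorm_smul hs, slopeNorm_smul_weights, penalizedRisk, slopeNorm_smul_weights,
      localLoss, Finset.sum_sub_distrib]
    field_simp
    ring
  intro u _
  have h1 : β₀ + (√(n : ℝ))⁻¹ • (√(n : ℝ) • (β - β₀)) = β := by
    rw [smul_smul, inv_mul_cancel₀ hs.ne', one_smul, add_sub_cancel]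
  have h2 : penalizedRisk g lam n Z β ≤ penalizedRisk g lam n Z (β₀ + (√(n : ℝ))⁻¹ • u) :=
    h (Set.mem_univ _)
  simp only [Set.mem_ofPred_eq, key, h1]
  linarith [mul_le_mul_of_nonneg_left h2 hn0.le]

end Expansion

/-! ### Convergence in distribution from good realisations -/

/-- A measurable image of a limit in distribution is the limit in distribution of every sequence
that converges along all good realisations of the driving sequence. -/
theorem tendstoInDistribution_of_forall_seq {E F Ω Ω' : Type*} [PseudoMetricSpace E]
    [MeasurableSpace E] [BorelSpace E] [TopologicalSpace F] [MeasurableSpace F] [BorelSpace F]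
    [MeasurableSpace Ω] [MeasurableSpace Ω'] {μ : Measure Ω} [IsProbabilityMeasure μ]
    {μ' : Measure Ω'} [IsProbabilityMeasure μ'] {X : ℕ → Ω → E} {W : Ω' → E}
    (h : TendstoInDistribution X atTop W (fun _ => μ) μ') {H : ℕ → ℕ → Set Ω}
    (hH_anti : ∀ n, Antitone (H n)) (hH : ∀ k, Tendsto (fun n => μ (H n k)ᶜ) atTop (𝓝 0))
    {Y : ℕ → Ω → F} (hY : ∀ n, AEMeasurable (Y n) μ) {ψ : E → F} (hψ : Measurable ψ)
    (hstable : ∀ᵐ w ∂(μ'.map W), ∀ (n : ℕ → ℕ) (ω : ℕ → Ω), (∀ k, k ≤ n k) →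
      (∀ k, ω k ∈ H (n k) k) → (∀ k : ℕ, dist (X (n k) (ω k)) w < 1 / ((k : ℝ) + 1)) →
      Tendsto (fun k => Y (n k) (ω k)) atTop (𝓝 (ψ w))) :
    TendstoInDistribution Y atTop (fun ω' => ψ (W ω')) (fun _ => μ) μ' := by
  have hW := h.aemeasurable_limit
  refine ⟨hY, hψ.comp_aemeasurable hW, tendsto_of_forall_isOpen_le_liminf' fun G hG => ?_⟩
  simp only [ProbabilityMeasure.coe_mk]
  have h1 : μ'.map (fun ω' => ψ (W ω')) G = μ'.map W (ψ ⁻¹' G) := by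
    have hψW : AEMeasurable (fun ω' => ψ (W ω')) μ' := hψ.comp_aemeasurable hW
    rw [Measure.map_apply_of_aemeasurable hψW hG.measurableSet,
      Measure.map_apply_of_aemeasurable hW (hψ hG.measurableSet)]
    rfl
  have h2 : ∀ n, μ.map (Y n) G = μ (Y n ⁻¹' G) := fun n =>
    Measure.map_apply_of_aemeasurable (hY n) hG.measurableSet
  simp only [h1, h2]
  refine measure_le_liminf_of_tendstoInDistribution h hH_anti hH ?_
  filter_upwards [hstable] with w hw hwG
  -- If every tolerance k fails, the failures form a sequence of good realisations along which Y
  -- stays outside the open set G.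
  by_contra hcon
  push Not at hcon
  choose n hn ω hωH hdist hω using hcon
  obtain ⟨k, hk⟩ := ((hw n ω hn hωH hdist).eventually (hG.mem_nhds hwG)).exists
  exact hω k hk

/-! ### Measurability of patterns and the false discovery rate -/

section Patterns

variable {p : ℕ}

/-- Such a function is constant on each of finitely many measurable sign cells. -/
lemma measurable_of_rootSigns {α : Type*} [MeasurableSpace α] {F : EuclideanSpace ℝ (Fin p) → α}
    (hF : ∀ u v, rootSigns u = rootSigns v → F u = F v) : Measurable F := by
  have hsign : ∀ (a : Fin p × Fin p × Bool) (s : SignType),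
      MeasurableSet {u : EuclideanSpace ℝ (Fin p) | SignType.sign (signedRoot a u) = s} := by
    intro a s
    have hm : Measurable fun u : EuclideanSpace ℝ (Fin p) => signedRoot a u :=
      (signedRoot a).continuous.measurable
    cases s
    · have : {u : EuclideanSpace ℝ (Fin p) | SignType.sign (signedRoot a u) = SignType.zero} =
          {u | signedRoot a u = 0} := Set.ext fun u => sign_eq_zero_iff
      rw [this]
      exact measurableSet_eq_fun hm measurable_const
    · have : {u : EuclideanSpace ℝ (Fin p) | SignType.sign (signedRoot a u) = SignType.neg} =
          {u | signedRoot a u < 0} := Set.ext fun u => sign_eq_neg_one_iff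
      rw [this]
      exact measurableSet_lt hm measurable_const
    · have : {u : EuclideanSpace ℝ (Fin p) | SignType.sign (signedRoot a u) = SignType.pos} =
          {u | 0 < signedRoot a u} := Set.ext fun u => sign_eq_one_iff
      rw [this]
      exact measurableSet_lt measurable_const hm
  have hcell : ∀ σ : Fin p × Fin p × Bool → SignType,
      MeasurableSet {u : EuclideanSpace ℝ (Fin p) | rootSigns u = σ} := by
    intro σ
    have : {u : EuclideanSpace ℝ (Fin p) | rootSigns u = σ} =
        ⋂ a, {u | SignType.sign (signedRoot a u) = σ a} := by
      ext u
      simp only [Set.mem_iInter, Set.mem_ofPred_eq, funext_iff, rootSigns]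
    rw [this]
    exact MeasurableSet.iInter fun a => hsign a (σ a)
  intro s _
  have : F ⁻¹' s = ⋃ σ ∈ {σ | ∃ v, rootSigns v = σ ∧ F v ∈ s},
      {u : EuclideanSpace ℝ (Fin p) | rootSigns u = σ} := by
    ext u
    simp only [Set.mem_iUnion, Set.mem_ofPred_eq, Set.mem_preimage, exists_prop]
    constructor
    · exact fun hu => ⟨_, ⟨u, rfl, hu⟩, rfl⟩
    · rintro ⟨σ, ⟨v, hv, hvs⟩, hu⟩
      rwa [hF u v (hu.trans hv.symm)]
  rw [this]
  exact MeasurableSet.biUnion (Set.to_countable _) fun σ _ => hcell σ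

lemma measurable_slopePattern : Measurable (slopePattern (p := p)) :=
  measurable_of_rootSigns fun _ _ => slopePattern_eq_of_rootSigns_eq

lemma measurable_limitingPattern (β₀ : EuclideanSpace ℝ (Fin p)) :
    Measurable (limitingPattern β₀) :=
  measurable_of_rootSigns fun _ _ => limitingPattern_eq_of_rootSigns_eq β₀

lemma falseDiscoveryProportion_slopePattern (β₀ b : EuclideanSpace ℝ (Fin p)) :
    falseDiscoveryProportion β₀ (slopePattern b) = falseDiscoveryProportion β₀ b.ofLp := by
  simp only [falseDiscoveryProportion, ne_eq, slopePattern_eq_zero_iff]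

lemma norm_falseDiscoveryProportion_le {α : Type*} [Zero α] (β₀ : EuclideanSpace ℝ (Fin p))
    (b : Fin p → α) : ‖falseDiscoveryProportion β₀ b‖ ≤ 1 := by
  rw [falseDiscoveryProportion, Real.norm_of_nonneg (by positivity)]
  refine div_le_one_of_le₀ (le_max_of_le_right ?_) (by positivity)
  have hsub : {i | b i ≠ 0 ∧ β₀ i = 0} ⊆ {i | b i ≠ 0} := fun i hi => hi.1
  exact_mod_cast Set.ncard_le_ncard hsub (Set.toFinite _)

/-- Convergence in distribution of patterns entails convergence of the false discovery rate. -/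
lemma tendsto_falseDiscoveryRate {Ω Ω' : Type*} [MeasurableSpace Ω] [MeasurableSpace Ω']
    {μ : Measure Ω} [IsProbabilityMeasure μ] {μ' : Measure Ω'} [IsProbabilityMeasure μ']
    (β₀ : EuclideanSpace ℝ (Fin p)) {b : ℕ → Ω → Fin p → ℤ} {b' : Ω' → Fin p → ℤ}
    (h : TendstoInDistribution b atTop b' (fun _ => μ) μ') :
    Tendsto (fun n => falseDiscoveryRate β₀ μ (b n)) atTop (𝓝 (falseDiscoveryRate β₀ μ' b')) := by
  let f : BoundedContinuousFunction (Fin p → ℤ) ℝ :=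
    BoundedContinuousFunction.ofNormedAddCommGroup (fun b => falseDiscoveryProportion β₀ b)
      continuous_of_discreteTopology 1 (norm_falseDiscoveryProportion_le β₀)
  have h1 := ProbabilityMeasure.tendsto_iff_forall_integral_tendsto.1 h.tendsto f
  simp only [ProbabilityMeasure.coe_mk] at h1
  rw [integral_map h.aemeasurable_limit f.continuous.aestronglyMeasurable] at h1
  refine h1.congr fun n => ?_
  rw [integral_map (h.forall_aemeasurable n) f.continuous.aestronglyMeasurable]
  rfl

end Patterns

/-! ### The limiting objective and its minimiser map -/

lemma limitObjective_eq {p : ℕ} (C : Matrix (Fin p) (Fin p) ℝ) (lam : Fin p → ℝ)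
    (β₀ w u : EuclideanSpace ℝ (Fin p)) :
    limitObjective C lam β₀ w u =
      1 / 2 * inner ℝ u (Matrix.toEuclideanCLM (n := Fin p) (𝕜 := ℝ) C u) - inner ℝ u w +
        slopeDirDeriv lam β₀ u := by
  rw [limitObjective, Matrix.inner_toEuclideanCLM]
  simp only [PiLp.inner_apply, RCLike.inner_apply, conj_trivial, dotProduct, mul_comm]

/-- The minimiser of a coercive quadratic function plus a convex function depends continuously
on the linear term. -/
lemma continuous_minimizer {E : Type*} [NormedAddCommGroup E] [InnerProductSpace ℝ E]
    [FiniteDimensional ℝ E] {A : E →L[ℝ] E} (hA : ∀ u, 0 ≤ inner ℝ u (A u))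
    (hsym : ∀ u v, inner ℝ (A u) v = inner ℝ u (A v)) {h : E → ℝ}
    (hconv : ConvexOn ℝ Set.univ h) {φ : E → E}
    (hφ : ∀ w y, y ≠ φ w → 1 / 2 * inner ℝ (φ w) (A (φ w)) - inner ℝ (φ w) w + h (φ w) <
      1 / 2 * inner ℝ y (A y) - inner ℝ y w + h y) : Continuous φ := by
  have hcont : Continuous h := continuousOn_univ.1 (hconv.continuousOn isOpen_univ)
  have hquad : ∀ w : E, ConvexOn ℝ Set.univ
      (fun y => 1 / 2 * inner ℝ y (A y) - inner ℝ y w + h y) := by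
    refine fun w => ConvexOn.add ⟨convex_univ, fun x _ y _ a b ha hb hab => ?_⟩ hconv
    have h1 := hA (x - y)
    have h2 : inner ℝ y (A x) = inner ℝ x (A y) := by rw [← hsym, real_inner_comm]
    obtain rfl : b = 1 - a := by linarith
    simp only [map_add, map_smul, map_sub, inner_add_left, inner_add_right, inner_sub_left,
      inner_sub_right, real_inner_smul_left, real_inner_smul_right, smul_eq_mul, h2] at h1 ⊢
    nlinarith [mul_nonneg (mul_nonneg ha hb) h1]
  refine SeqContinuous.continuous fun wk w hw => ?_
  have hw' : Tendsto wk atTop (𝓝 w) := hw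
  refine tendsto_of_isMinOn_of_convexOn
    (Q := fun y => 1 / 2 * inner ℝ y (A y) - inner ℝ y w + h y) (by fun_prop) (hφ w)
    (fun k => hquad (wk k)) ?_ ?_
  · intro R ε hε
    have h1 : Tendsto (fun k => |R| * ‖wk k - w‖) atTop (𝓝 0) := by
      simpa using (tendsto_iff_norm_sub_tendsto_zero.1 hw').const_mul |R|
    filter_upwards [h1.eventually_le_const hε] with k hk y hy
    have h2 : 1 / 2 * inner ℝ y (A y) - inner ℝ y (wk k) + h y -
        (1 / 2 * inner ℝ y (A y) - inner ℝ y w + h y) = -inner ℝ y (wk k - w) := by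
      rw [inner_sub_right]
      ring
    rw [h2, abs_neg]
    exact (abs_real_inner_le_norm _ _).trans ((mul_le_mul_of_nonneg_right
      (hy.trans (le_abs_self R)) (norm_nonneg _)).trans hk)
  · intro k y _
    by_cases hy : y = φ (wk k)
    · subst hy
      exact le_rfl (a := 1 / 2 * inner ℝ (φ (wk k)) (A (φ (wk k))) -
        inner ℝ (φ (wk k)) (wk k) + h (φ (wk k)))
    · exact (hφ (wk k) y hy).le

/-! ### The main theorem -/

theorem mainTheorem1 {p : ℕ} {Ω Ω' : Type*} [MeasurableSpace Ω] [MeasurableSpace Ω']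
    (μ : Measure Ω) [IsProbabilityMeasure μ] (μ' : Measure Ω') [IsProbabilityMeasure μ']
    -- i.i.d. observations `(y i, X i)` with common law `P`
    (P : Measure (ℝ × EuclideanSpace ℝ (Fin p)))
    (y : ℕ → Ω → ℝ) (X : ℕ → Ω → EuclideanSpace ℝ (Fin p))
    (hlaw : ∀ i, HasLaw (fun ω => (y i ω, X i ω)) P μ)
    (hindep : iIndepFun (fun i ω => (y i ω, X i ω)) μ)
    -- the convex loss
    (g : ℝ × EuclideanSpace ℝ (Fin p) → EuclideanSpace ℝ (Fin p) → ℝ)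
    (hg_conv : ∀ z, ConvexOn ℝ Set.univ (g z))
    (hg_meas : ∀ β, Measurable fun z => g z β)
    (hg_int : ∀ β, Integrable (fun z => g z β) P)
    -- a non-singular Hessian of `G β = E g(·, β)` at the minimiser `β₀`
    (β₀ : EuclideanSpace ℝ (Fin p)) (C : Matrix (Fin p) (Fin p) ℝ)
    (hmin : IsMinOn (fun β => ∫ z, g z β ∂P) Set.univ β₀)
    (hHess : HasHessianAt (fun β => ∫ z, g z β ∂P) C β₀)
    (hC : IsUnit C.det)
    -- a centred score with finite second moment
    (Δ : ℝ × EuclideanSpace ℝ (Fin p) → EuclideanSpace ℝ (Fin p))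
    (hΔ_meas : Measurable Δ) (hΔ_sq : MemLp Δ 2 P) (hΔ_mean : ∫ z, Δ z ∂P = 0)
    -- stochastic differentiability
    (hsd : StochasticallyDifferentiableAt μ P (fun i ω => (y i ω, X i ω)) g Δ β₀)
    -- the penalties
    (lamSeq : ℕ → Fin p → ℝ) (lam : Fin p → ℝ)
    (hlam_anti : ∀ n, Antitone (lamSeq n)) (hlam_nonneg : ∀ n i, 0 ≤ lamSeq n i)
    (hlam : Tendsto (fun n : ℕ => (√(n : ℝ))⁻¹ • lamSeq n) atTop (𝓝 lam))
    -- the estimators, which minimise the penalised risk with probability tending to one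
    (βhat : ℕ → Ω → EuclideanSpace ℝ (Fin p)) (hβ_meas : ∀ n, AEMeasurable (βhat n) μ)
    (hβ_min : Tendsto (fun n => μ {ω | ¬ IsMinOn
      (penalizedRisk g (lamSeq n) n fun i => (y i ω, X i ω)) Set.univ (βhat n ω)}) atTop (𝓝 0))
    -- the Gaussian vector of the limiting problem
    (W : Ω' → EuclideanSpace ℝ (Fin p))
    (hW : HasLaw W (multivariateGaussian 0 (secondMomentMatrix P Δ)) μ') :
    ∃ uhat : Ω' → EuclideanSpace ℝ (Fin p),
      (∀ ω', IsMinOn (limitObjective C lam β₀ (W ω')) Set.univ (uhat ω') ∧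
        ∀ u, IsMinOn (limitObjective C lam β₀ (W ω')) Set.univ u → u = uhat ω') ∧
      TendstoInDistribution (fun (n : ℕ) ω => √(n : ℝ) • (βhat n ω - β₀)) atTop uhat
        (fun _ => μ) μ' ∧
      (IsUnit (secondMomentMatrix P Δ).det →
        TendstoInDistribution (fun (n : ℕ) ω => slopePattern (√(n : ℝ) • (βhat n ω - β₀))) atTop
          (fun ω' => slopePattern (uhat ω')) (fun _ => μ) μ' ∧
        TendstoInDistribution (fun n ω => slopePattern (βhat n ω)) atTop
          (fun ω' => limitingPattern β₀ (uhat ω')) (fun _ => μ) μ' ∧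
        Tendsto (fun n => falseDiscoveryRate β₀ μ fun ω => (βhat n ω).ofLp) atTop
          (𝓝 (falseDiscoveryRate β₀ μ' fun ω' => limitingPattern β₀ (uhat ω')))) := by
  have hP : IsProbabilityMeasure P := (hlaw 0).isProbabilityMeasure_iff.1 inferInstance
  set Z : ℕ → Ω → ℝ × EuclideanSpace ℝ (Fin p) := fun i ω => (y i ω, X i ω) with hZ
  set A := Matrix.toEuclideanCLM (n := Fin p) (𝕜 := ℝ) C with hA
  have hsym : ∀ u v, inner ℝ (A u) v = inner ℝ u (A v) := hHess.inner_comm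
  obtain ⟨c, hc, hcoer⟩ := hHess.exists_coercive hmin hC
  set lamN : ℕ → Fin p → ℝ := fun n => (√(n : ℝ))⁻¹ • lamSeq n with hlamN
  have hN_anti : ∀ n, Antitone (lamN n) := fun n i j hij =>
    mul_le_mul_of_nonneg_left (hlam_anti n hij) (by positivity)
  have hN_nonneg : ∀ n i, 0 ≤ lamN n i := fun n i =>
    mul_nonneg (by positivity) (hlam_nonneg n i)
  have hlam_anti' : Antitone lam := fun i j hij =>
    le_of_tendsto_of_tendsto' (tendsto_pi_nhds.1 hlam j) (tendsto_pi_nhds.1 hlam i)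
      fun n => hN_anti n hij
  have hlam_nonneg' : ∀ i, 0 ≤ lam i := fun i =>
    ge_of_tendsto' (tendsto_pi_nhds.1 hlam i) fun n => hN_nonneg n i
  have hconv := convexOn_slopeDirDeriv hlam_anti' hlam_nonneg' β₀
  -- The limiting minimiser is a deterministic continuous function φ of the Gaussian vector, which
  -- settles its measurability.
  choose φ hφ using exists_unique_minimizer hsym hc hcoer hconv
    (abs_slopeDirDeriv_le hlam_anti' hlam_nonneg' β₀)
  have hφc : Continuous φ := continuous_minimizer
    (fun u => (mul_nonneg hc.le (sq_nonneg _)).trans (hcoer u)) hsym hconv hφ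
  set S : ℕ → Ω → EuclideanSpace ℝ (Fin p) :=
    fun n ω => normalizedScore Δ n fun i => Z i ω with hS
  have hclt : TendstoInDistribution S atTop W (fun _ => μ) μ' :=
    tendstoInDistribution_inv_sqrt_smul_sum hlaw hindep (Δ := fun z => -Δ z) hΔ_meas.neg hΔ_sq.neg
      (by rw [integral_neg, hΔ_mean, neg_zero]) (by rwa [secondMomentMatrix_neg])
  -- The good event at tolerance k: the estimator is a minimiser and the quadratic expansion holds
  -- on the ball of radius k up to 1/(k + 1).
  set H : ℕ → ℕ → Set Ω := fun n k => {ω | 0 < n ∧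
    IsMinOn (penalizedRisk g (lamSeq n) n fun i => Z i ω) Set.univ (βhat n ω) ∧
    ∀ u : EuclideanSpace ℝ (Fin p), ‖u‖ ≤ k →
      |localLoss g β₀ n (fun i => Z i ω) u - (1 / 2 * inner ℝ u (A u) - inner ℝ u (S n ω))| ≤
        1 / ((k : ℝ) + 1)} with hH
  have hH_anti : ∀ n, Antitone (H n) := by
    rintro n j k hjk ω ⟨hn, hω1, hω2⟩
    have hjk' : (j : ℝ) ≤ k := by exact_mod_cast hjk
    refine ⟨hn, hω1, fun u hu => (hω2 u (hu.trans hjk')).trans ?_⟩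
    gcongr
  have hH_lim : ∀ k, Tendsto (fun n => μ (H n k)ᶜ) atTop (𝓝 0) := by
    intro k
    have h1 := hβ_min.add (tendsto_measure_localLoss_sub_quadratic hg_int
      (hΔ_sq.integrable one_le_two) hΔ_mean hmin hHess hsd k)
    rw [add_zero] at h1
    refine tendsto_of_tendsto_of_tendsto_of_le_of_le' tendsto_const_nhds h1
      (Eventually.of_forall fun _ => zero_le) ?_
    filter_upwards [eventually_gt_atTop 0] with n hn
    refine (measure_mono fun ω hω => ?_).trans (measure_union_le _ _)
    by_contra hcon
    rw [Set.mem_union, not_or] at hcon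
    exact hω ⟨hn, not_not.1 hcon.1, not_not.1 hcon.2⟩
  have hquad : ∀ (w : EuclideanSpace ℝ (Fin p)) (n : ℕ → ℕ) (ω : ℕ → Ω),
      (∀ k, ω k ∈ H (n k) k) → (∀ k : ℕ, dist (S (n k) (ω k)) w < 1 / ((k : ℝ) + 1)) →
      ∀ R ε : ℝ, 0 < ε → ∀ᶠ k in atTop, ∀ u : EuclideanSpace ℝ (Fin p), ‖u‖ ≤ R →
        |localLoss g β₀ (n k) (fun i => Z i (ω k)) u -
          (1 / 2 * inner ℝ u (A u) - inner ℝ u w)| ≤ ε := by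
    intro w n ω hω hdist R ε hε
    have h1 : Tendsto (fun k : ℕ => (1 + |R|) * (1 / ((k : ℝ) + 1))) atTop (𝓝 0) := by
      simpa using tendsto_one_div_add_atTop_nhds_zero_nat.const_mul (1 + |R|)
    filter_upwards [h1.eventually_le_const hε,
      tendsto_natCast_atTop_atTop.eventually_ge_atTop R] with k hk hkR u hu
    have h2 := (hω k).2.2 u (hu.trans hkR)
    have h3 : |inner ℝ u (S (n k) (ω k)) - inner ℝ u w| ≤ |R| * (1 / ((k : ℝ) + 1)) := by
      rw [← inner_sub_right]
      refine (abs_real_inner_le_norm _ _).trans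
        (mul_le_mul (hu.trans (le_abs_self R)) ?_ (norm_nonneg _) (abs_nonneg R))
      rw [← dist_eq_norm]
      exact (hdist k).le
    rw [abs_le] at h2 h3 ⊢
    constructor <;> linarith [h2.1, h2.2, h3.1, h3.2]
  have hsqrt : ∀ n : ℕ → ℕ, (∀ k, k ≤ n k) → Tendsto (fun k => √(n k : ℝ)) atTop atTop :=
    fun n hn => Real.tendsto_sqrt_atTop.comp
      (tendsto_natCast_atTop_atTop.comp (tendsto_atTop_mono hn tendsto_id))
  have hlocal : ∀ (w : EuclideanSpace ℝ (Fin p)) (n : ℕ → ℕ) (ω : ℕ → Ω), (∀ k, k ≤ n k) →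
      (∀ k, ω k ∈ H (n k) k) → (∀ k : ℕ, dist (S (n k) (ω k)) w < 1 / ((k : ℝ) + 1)) → _ :=
    fun w n ω hn hω hdist => tendsto_localMinimizers hlam_anti' hlam_nonneg' (hφ w)
      (hsqrt n hn) (fun k => hN_anti (n k)) (fun k => hN_nonneg (n k))
      (hlam.comp (tendsto_atTop_mono hn tendsto_id))
      (fun k => convexOn_localLoss hg_conv β₀ (n k) fun i => Z i (ω k))
      (hquad w n ω hω hdist)
      (fun k => isMinOn_localLoss_add_slopeNorm (hω k).1 (hω k).2.1 β₀)
  have hu_meas : ∀ n : ℕ, AEMeasurable (fun ω => √(n : ℝ) • (βhat n ω - β₀)) μ := fun n =>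
    (measurable_const_smul (√(n : ℝ))).comp_aemeasurable ((hβ_meas n).sub_const β₀)
  refine ⟨fun ω' => φ (W ω'), fun ω' => ⟨fun u _ => ?_, fun u hu => ?_⟩, ?_, fun hdet => ?_⟩
  · simp only [Set.mem_ofPred_eq, limitObjective_eq]
    by_cases hu : u = φ (W ω')
    · rw [hu]
    · exact (hφ (W ω') u hu).le
  · by_contra hne
    have h1 : limitObjective C lam β₀ (W ω') u ≤ limitObjective C lam β₀ (W ω') (φ (W ω')) :=
      hu (Set.mem_univ _)
    rw [limitObjective_eq, limitObjective_eq] at h1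
    exact absurd h1 (not_le.2 (hφ (W ω') u hne))
  · exact tendstoInDistribution_of_forall_seq hclt hH_anti hH_lim hu_meas hφc.measurable
      (Eventually.of_forall fun w n ω hn hω hdist => (hlocal w n ω hn hω hdist).1)
  · have hpd : (secondMomentMatrix P Δ).PosDef :=
      (posSemidef_secondMomentMatrix hΔ_sq).posDef_iff_det_ne_zero.2 hdet.ne_zero
    have hae := ae_eventually_rootSigns_eq hsym β₀ lam (μ'.map W) fun v b hv => by
      rw [hW.map_eq]
      exact multivariateGaussian_hyperplane hpd hv b
    have hsigns : ∀ᵐ w ∂(μ'.map W), ∀ (n : ℕ → ℕ) (ω : ℕ → Ω), (∀ k, k ≤ n k) →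
        (∀ k, ω k ∈ H (n k) k) → (∀ k : ℕ, dist (S (n k) (ω k)) w < 1 / ((k : ℝ) + 1)) →
        ∀ᶠ k in atTop,
          rootSigns (√(n k : ℝ) • (βhat (n k) (ω k) - β₀)) = rootSigns (φ w) := by
      filter_upwards [hae] with w hw n ω hn hω hdist
      have hloc := hlocal w n ω hn hω hdist
      exact hw (φ w) (fun k => lamN (n k)) _ _ (fun k => hN_anti (n k))
        (fun k => hN_nonneg (n k)) (hlam.comp (tendsto_atTop_mono hn tendsto_id))
        (fun k => convexOn_localLoss hg_conv β₀ (n k) fun i => Z i (ω k))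
        (hquad w n ω hω hdist) hloc.1 hloc.2.1
    have hpatt : TendstoInDistribution (fun n ω => slopePattern (βhat n ω)) atTop
        (fun ω' => limitingPattern β₀ (φ (W ω'))) (fun _ => μ) μ' := by
      refine tendstoInDistribution_of_forall_seq hclt hH_anti hH_lim
        (ψ := fun w => limitingPattern β₀ (φ w))
        (fun n => measurable_slopePattern.comp_aemeasurable (hβ_meas n))
        ((measurable_limitingPattern β₀).comp hφc.measurable) ?_
      filter_upwards [hsigns] with w hw n ω hn hω hdist
      refine tendsto_const_nhds.congr' ?_
      filter_upwards [hw n ω hn hω hdist, (hlocal w n ω hn hω hdist).2.2] with k hk1 hk2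
      have hpos : 0 < √(n k : ℝ) := Real.sqrt_pos.2 (by exact_mod_cast (hω k).1)
      -- The limiting pattern at the rescaled error is the pattern of √n β₀ + √n(β̂ − β₀) = √n β̂,
      -- hence of β̂.
      rw [← limitingPattern_eq_of_rootSigns_eq β₀ hk1, hk2, ← smul_add, add_sub_cancel]
      exact slopePattern_eq_of_rootSigns_eq (rootSigns_smul hpos _)
    refine ⟨?_, hpatt, ?_⟩
    · refine tendstoInDistribution_of_forall_seq hclt hH_anti hH_lim
        (ψ := fun w => slopePattern (φ w))
        (fun n => measurable_slopePattern.comp_aemeasurable (hu_meas n))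
        (measurable_slopePattern.comp hφc.measurable) ?_
      filter_upwards [hsigns] with w hw n ω hn hω hdist
      refine tendsto_const_nhds.congr' ?_
      filter_upwards [hw n ω hn hω hdist] with k hk
      exact (slopePattern_eq_of_rootSigns_eq hk).symm
    · refine (tendsto_falseDiscoveryRate β₀ hpatt).congr fun n => ?_
      simp only [falseDiscoveryRate, falseDiscoveryProportion_slopePattern]
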